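/- Let $n\ge 2$. For $z,w\in\mathbb C^{n+1}$ write $z\cdot w=\sum_{i=1}^{n+1}z_iw_i$, $|z|^2=z\cdot\bar z$, let $$\mathbb H=\{z\in\mathbb C^{n+1}: z\cdot z=0,\ z\ne 0\}$$ be the Kepler manifold, and for $0\le R\le\infty$ let $R\mathbb M=\{z\in\mathbb H:|z|<R\}$ (so $R\mathbb M=\mathbb H$ if $R=\infty$). Let $\mu$ be the $O(n+1,\mathbb R)$-invariant probability measure on $\partial\mathbb M=\{z\in\mathbb H:|z|=1\}$, that is, the image of the normalized Haar measure of $O(n+1,\mathbb R)$ under $g\mapsto g\,(1,i,0,\dots,0)/\sqrt2$. Let $\rho$ be a finite nonnegative Borel measure on $(0,\infty)$, let $\rho\times\mu$ be the measure on $\mathbb H$ with $$\int_{\mathbb H} f\,d(\rho\times\mu)=\int_0^\infty\int_{\partial\mathbb M}f(t\zeta)\,d\mu(\zeta)\,d\rho(t),$$ and let $R=\sup\{t>0:t\in\operatorname{supp}\rho\}\in[0,\infty]$ (with $R=0$ if $\rho=0$). Assume that $\rho(\{R\})=0$ if $R<\infty$. Let $A^2_{\rho\times\mu}$ be the space of all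 holomorphic functions on $R\mathbb M$ that are square-integrable with respect to $\rho\times\mu$. Let $$q_k=\int_0^\infty t^k\,d\rho(t)\in[0,\infty],\qquad N(l)=\binom{l+n-1}{n-1}+\binom{l+n-2}{n-1},\qquad d_l=\frac{q_{2l}}{N(l)}.$$ Then there is exactly one function $K$ on $R\mathbb M\times R\mathbb M$ such that $K(\cdot,w)\in A^2_{\rho\times\mu}$ for each $w\in R\mathbb M$, $K(w,z)=\overline{K(z,w)}$ for all $z,w\in R\mathbb M$, and $$f(z)=\int_{R\mathbb M}f(w)K(z,w)\,d(\rho\times\mu)(w)\qquad\text{for all } f\in A^2_{\rho\times\mu},\ z\in R\mathbb M$$ (the integrand being integrable); this reproducing kernel is given by $$K(z,w)=\sum_{l=0}^\infty\frac{(z\cdot\bar w)^l}{d_l}\qquad\text{for all } z,w\in R\mathbb M,$$ where the series converges absolutely and a term with $d_l=\infty$ is read as $0$. Moreover, for all $l\ge0$, $$N(l)=\frac{(2l+n-1)\,(l+n-2)!}{l!\,(n-1)!}.$$ -/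

import Mathlib

open MeasureTheory
open scoped ENNReal

noncomputable section

namespace Kepler

/-- Complex Euclidean space `ℂ^{n+1}`. -/
abbrev Amb (n : ℕ) : Type := EuclideanSpace ℂ (Fin (n + 1))

/-- The bilinear pairing `z · w = ∑ i, z i * w i`. -/
def cdot {n : ℕ} (z w : Amb n) : ℂ := ∑ i, z i * w i

/-- The entrywise complex conjugate of a vector. -/
def cconj {n : ℕ} (w : Amb n) : Amb n := WithLp.toLp 2 (fun i => (starRingEnd ℂ) (w i))

/-- The Kepler manifold `H = {z ∈ ℂ^{n+1} : z · z = 0, z ≠ 0}`. -/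
def keplerManifold (n : ℕ) : Set (Amb n) := {z | cdot z z = 0 ∧ z ≠ 0}

/-- The set `R M = {z ∈ H : |z| < R}`, for `0 ≤ R ≤ ∞`; it is all of `H` when `R = ∞`. -/
def keplerBall (n : ℕ) (R : ℝ≥0∞) : Set (Amb n) :=
  {z | z ∈ keplerManifold n ∧ ENNReal.ofReal ‖z‖ < R}

/-- The orthogonal group `O(n+1, ℝ)`, with the topology of matrices. -/
abbrev OrthGroup (n : ℕ) : Type := Matrix.orthogonalGroup (Fin (n + 1)) ℝ

instance instCompactSpaceOrthGroup (n : ℕ) : CompactSpace (OrthGroup n) := by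
  have hc : IsCompact (Set.univ.pi fun _ : Fin (n + 1) => Set.univ.pi fun _ : Fin (n + 1) =>
      Set.Icc (-1 : ℝ) 1) :=
    isCompact_univ_pi fun _ => isCompact_univ_pi fun _ => isCompact_Icc
  have hcl : IsClosed ((unitary (Matrix (Fin (n + 1)) (Fin (n + 1)) ℝ) :
      Submonoid (Matrix (Fin (n + 1)) (Fin (n + 1)) ℝ)) :
      Set (Matrix (Fin (n + 1)) (Fin (n + 1)) ℝ)) := isClosed_unitary
  refine isCompact_iff_compactSpace.mp (hc.of_isClosed_subset hcl ?_)
  intro g hg i _ j _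
  have h := entry_norm_bound_of_unitary (𝕜 := ℝ) hg i j
  rw [Real.norm_eq_abs] at h
  exact abs_le.mp h

instance instMeasurableSpaceOrthGroup (n : ℕ) : MeasurableSpace (OrthGroup n) := borel _

instance instBorelSpaceOrthGroup (n : ℕ) : BorelSpace (OrthGroup n) := ⟨rfl⟩

/-- The natural action of a real orthogonal matrix on `ℂ^{n+1}`. -/
def orthAct {n : ℕ} (g : OrthGroup n) (z : Amb n) : Amb n :=
  WithLp.toLp 2 (fun i => ∑ j, (((g : Matrix (Fin (n + 1)) (Fin (n + 1)) ℝ) i j : ℝ) : ℂ) * z j)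

/-- The unit vector `(1, i, 0, …, 0) / √2`. -/
def basePoint (n : ℕ) : Amb n :=
  WithLp.toLp 2 (fun j =>
    ((if (j : ℕ) = 0 then 1 else if (j : ℕ) = 1 then Complex.I else 0) / (Real.sqrt 2 : ℂ)))

/-- The `O(n+1, ℝ)`-invariant probability measure `μ` on `∂M = {z ∈ H : |z| = 1}`: the image of
the normalized Haar measure of `O(n+1, ℝ)` under `g ↦ g • (1, i, 0, …, 0) / √2`, whose range is
`∂M`. -/
def sphereMeasure (n : ℕ) : Measure (Amb n) :=
  Measure.map (fun g : OrthGroup n => orthAct g (basePoint n))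
    (Measure.haarMeasure (⊤ : TopologicalSpace.PositiveCompacts (OrthGroup n)))

/-- The measure `ρ × μ` on `H`, given by `∫ f d(ρ × μ) = ∫ ∫ f (t ζ) dμ(ζ) dρ(t)`. -/
def rotMeasure (n : ℕ) (ρ : Measure ℝ) : Measure (Amb n) :=
  Measure.map (fun p : ℝ × Amb n => ((p.1 : ℝ) : ℂ) • p.2) (ρ.prod (sphereMeasure n))

/-- `R = sup {t > 0 : t ∈ supp ρ}`, as an element of `[0, ∞]`. -/
def radius (ρ : Measure ℝ) : ℝ≥0∞ :=
  sSup (ENNReal.ofReal '' {t : ℝ | 0 < t ∧ t ∈ ρ.support})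

/-- The moments `q_k = ∫ t^k dρ(t) ∈ [0, ∞]` of a measure on `(0, ∞)`. -/
def moment (ρ : Measure ℝ) (k : ℕ) : ℝ≥0∞ := ∫⁻ t in Set.Ioi 0, ENNReal.ofReal (t ^ k) ∂ρ

/-- `N(l) = C(l+n-1, n-1) + C(l+n-2, n-1)` (used for `n ≥ 2`). -/
def dimN (n l : ℕ) : ℕ := (l + n - 1).choose (n - 1) + (l + n - 2).choose (n - 1)

/-- `d_l = q_{2l} / N(l) ∈ [0, ∞]`. -/
def dCoeff (n : ℕ) (ρ : Measure ℝ) (l : ℕ) : ℝ≥0∞ := moment ρ (2 * l) / (dimN n l : ℝ≥0∞)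

/-- A function on a subset `S` of the complex manifold `H`, relatively open in `H`, is holomorphic
if near each point of `S` it is the restriction of a holomorphic function of the ambient space. -/
def IsHolomorphic {n : ℕ} {S : Set (Amb n)} (f : S → ℂ) : Prop :=
  ∀ z : S, ∃ U : Set (Amb n), IsOpen U ∧ (z : Amb n) ∈ U ∧
    ∃ F : Amb n → ℂ, DifferentiableOn ℂ F U ∧ ∀ w : S, (w : Amb n) ∈ U → f w = F w

/-- The restriction of `ρ × μ` to `R M`, `R = radius ρ`. -/
def ballMeasure (n : ℕ) (ρ : Measure ℝ) : Measure (keplerBall n (radius ρ)) :=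
  Measure.comap Subtype.val (rotMeasure n ρ)

/-- The weighted Bergman space `A²`: the functions holomorphic on `R M` and square-integrable
with respect to `ρ × μ`. -/
def bergmanSpace (n : ℕ) (ρ : Measure ℝ) : Submodule ℂ (keplerBall n (radius ρ) → ℂ) where
  carrier := {f | IsHolomorphic f ∧ MemLp f 2 (ballMeasure n ρ)}
  zero_mem' := ⟨fun _ => ⟨Set.univ, isOpen_univ, trivial, fun _ => 0,
    differentiableOn_const 0, fun _ _ => rfl⟩, MemLp.zero⟩
  add_mem' := by
    rintro f g ⟨hf, hf2⟩ ⟨hg, hg2⟩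
    refine ⟨fun z => ?_, hf2.add hg2⟩
    obtain ⟨U, hU, hzU, F, hF, hfF⟩ := hf z
    obtain ⟨V, hV, hzV, G, hG, hgG⟩ := hg z
    exact ⟨U ∩ V, hU.inter hV, ⟨hzU, hzV⟩, fun w => F w + G w,
      (hF.mono Set.inter_subset_left).add (hG.mono Set.inter_subset_right),
      fun w hw => by simp [hfF w hw.1, hgG w hw.2]⟩
  smul_mem' := by
    rintro c f ⟨hf, hf2⟩
    refine ⟨fun z => ?_, hf2.const_smul c⟩
    obtain ⟨U, hU, hzU, F, hF, hfF⟩ := hf z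
    exact ⟨U, hU, hzU, fun w => c * F w, hF.const_mul c, fun w hw => by simp [hfF w hw]⟩

/-- `K` is a reproducing kernel of the Bergman space `A²` on `R M`. -/
structure IsReproducingKernel (n : ℕ) (ρ : Measure ℝ)
    (K : keplerBall n (radius ρ) → keplerBall n (radius ρ) → ℂ) : Prop where
  mem : ∀ w, (fun z => K z w) ∈ bergmanSpace n ρ
  symm : ∀ z w, K w z = (starRingEnd ℂ) (K z w)
  reproducing : ∀ f ∈ bergmanSpace n ρ, ∀ z,
    Integrable (fun w => f w * K z w) (ballMeasure n ρ) ∧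
      f z = ∫ w, f w * K z w ∂(ballMeasure n ρ)

end Kepler

end

noncomputable section

namespace Kepler

section

variable {n m : ℕ}

/-! ### Bilinear algebra on `ℂ^{n+1}` -/

/-! Write `e` for the base point, `a = w · ē` (`coordA`) and `b = w · e` (`coordB`). In these
coordinates the cone is `2ab + ∑ w_j² = 0` and `|w|² = |a|² + |b|² + ∑ |w_j|²`. The orthogonal group
acts transitively on the unit vectors of the cone, so the reproducing formula need only be proved at
points `s e`, `s > 0`.

The main tool is `flow`: `(a, b, w_j) ↦ (a, t² b, t w_j)`. It preserves the cone and does not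
increase the norm for `|t| ≤ 1`; for `|t| = 1` it is a unimodular scalar times a rotation, so it
preserves `ρ × μ`; at `t = 0` it sends `w` to `a e`. The mean value property in `t`
(`circleAverage_flow`) thus replaces `F(w)` by `F(a e)` in integrals against functions of `a`. The
function `u ↦ F(u e)` has a removable singularity at `0` and a Taylor series `∑ a_l u^l`
(`exists_taylor_smul_basePoint`). A second average, over unimodular scalars, gives `∫ F ā^l = a_l ∫
|a|^{2l}` (`integral_mul_conj_coordA_pow`).

The moment `∫ |a|^{2l} dμ` equals `1 / N(l)` (`sphereMoment_eq`): integrating by parts along a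
nilpotent element of the complexified rotation algebra yields a recursion in `l` which `1 / N(l)`
also satisfies. Hence `∫ |a|^{2l} d(ρ × μ) = d_l`, and integrating `F` against the `l`-th term of
the kernel at `s e` gives `a_l s^l`. If `d_l = ∞`, square-integrability forces `a_l = 0`
(`taylor_eq_zero_of_lintegral_eq_top`), in agreement with the missing term.

Sum and integral may be interchanged since `∑ s^l / √d_l` converges for `s < R`
(`summable_pow_mul_sqrt_kerCoeff`); the same series bounds the `L²` norm of the kernel. Uniqueness
is the usual symmetry argument for reproducing kernels. -/

lemma cdot_comm (z w : Amb n) : cdot z w = cdot w z := by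
  simp only [cdot, mul_comm]

lemma cdot_smul_left (c : ℂ) (x y : Amb n) : cdot (c • x) y = c * cdot x y := by
  simp [cdot, Finset.mul_sum, mul_assoc]

lemma cdot_smul_right (c : ℂ) (x y : Amb n) : cdot x (c • y) = c * cdot x y := by
  rw [cdot_comm, cdot_smul_left, cdot_comm]

@[simp] lemma cconj_apply (w : Amb n) (i : Fin (n + 1)) :
    cconj w i = (starRingEnd ℂ) (w i) := rfl

lemma cconj_smul (c : ℂ) (w : Amb n) : cconj (c • w) = (starRingEnd ℂ) c • cconj w := by
  ext i; simp

lemma cdot_cconj_self (w : Amb n) : cdot w (cconj w) = ((‖w‖ ^ 2 : ℝ) : ℂ) := by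
  rw [EuclideanSpace.norm_sq_eq]
  simp [cdot, Complex.mul_conj, Complex.normSq_eq_norm_sq]

lemma cdot_cconj_eq_inner (z w : Amb n) : cdot z (cconj w) = inner ℂ w z := by
  simp [cdot, PiLp.inner_apply]

lemma norm_cdot_cconj_le (z w : Amb n) : ‖cdot z (cconj w)‖ ≤ ‖z‖ * ‖w‖ := by
  rw [cdot_cconj_eq_inner, mul_comm]
  exact norm_inner_le_norm w z

lemma cdot_cconj_symm (z w : Amb n) :
    cdot w (cconj z) = (starRingEnd ℂ) (cdot z (cconj w)) := by
  simp [cdot, mul_comm]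

lemma continuous_apply_amb (i : Fin (n + 1)) : Continuous fun w : Amb n => w i := by fun_prop

lemma continuous_cdot_left (w : Amb n) : Continuous fun z : Amb n => cdot z w := by
  unfold cdot; fun_prop

lemma differentiable_cdot_left (w : Amb n) : Differentiable ℂ fun z : Amb n => cdot z w := by
  unfold cdot
  fun_prop

lemma continuous_cdot_self : Continuous fun z : Amb n => cdot z z := by
  unfold cdot; fun_prop

/-! ### The action of the orthogonal group -/

@[simp] lemma orthAct_apply (g : OrthGroup n) (z : Amb n) (i : Fin (n + 1)) :
    orthAct g z i = ∑ j, (((g : Matrix (Fin (n + 1)) (Fin (n + 1)) ℝ) i j : ℝ) : ℂ) * z j := rfl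

lemma orthAct_mul (g h : OrthGroup n) (z : Amb n) :
    orthAct (g * h) z = orthAct g (orthAct h z) := by
  ext i
  simp only [orthAct_apply, Submonoid.coe_mul, Matrix.mul_apply, Finset.mul_sum]
  rw [Finset.sum_comm]
  simp only [Complex.ofReal_sum, Complex.ofReal_mul, Finset.sum_mul, mul_assoc]

lemma orthAct_smul (g : OrthGroup n) (c : ℂ) (z : Amb n) :
    orthAct g (c • z) = c • orthAct g z := by
  ext i
  simp only [orthAct_apply, PiLp.smul_apply, smul_eq_mul, Finset.mul_sum]
  exact Finset.sum_congr rfl fun _ _ => by ring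

lemma orthAct_cconj (g : OrthGroup n) (z : Amb n) : orthAct g (cconj z) = cconj (orthAct g z) := by
  ext i
  simp

lemma orthAct_sum_mul (g : OrthGroup n) (j k : Fin (n + 1)) :
    ∑ i, (g : Matrix (Fin (n + 1)) (Fin (n + 1)) ℝ) i j *
      (g : Matrix (Fin (n + 1)) (Fin (n + 1)) ℝ) i k = if j = k then 1 else 0 := by
  have h := (Matrix.mem_orthogonalGroup_iff' (Fin (n + 1)) ℝ).1 g.2
  have := congrFun (congrFun h j) k
  simpa [Matrix.mul_apply, Matrix.one_apply, Matrix.star_eq_conjTranspose] using this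

lemma cdot_orthAct (g : OrthGroup n) (z w : Amb n) :
    cdot (orthAct g z) (orthAct g w) = cdot z w := by
  have h : cdot (orthAct g z) (orthAct g w) = ∑ j, ∑ k, z j * w k *
      ((∑ i, (g : Matrix (Fin (n + 1)) (Fin (n + 1)) ℝ) i j *
      (g : Matrix (Fin (n + 1)) (Fin (n + 1)) ℝ) i k : ℝ) : ℂ) := by
    simp only [cdot, orthAct_apply, Finset.sum_mul_sum, Complex.ofReal_sum, Complex.ofReal_mul]
    rw [Finset.sum_comm]
    refine Finset.sum_congr rfl fun j _ => ?_
    rw [Finset.sum_comm]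
    refine Finset.sum_congr rfl fun k _ => ?_
    rw [Finset.mul_sum]
    exact Finset.sum_congr rfl fun i _ => by ring
  rw [h]
  simp [orthAct_sum_mul, cdot, apply_ite Complex.ofReal]

lemma cdot_cconj_orthAct (g : OrthGroup n) (z w : Amb n) :
    cdot (orthAct g z) (cconj (orthAct g w)) = cdot z (cconj w) := by
  rw [← orthAct_cconj, cdot_orthAct]

lemma norm_orthAct (g : OrthGroup n) (z : Amb n) : ‖orthAct g z‖ = ‖z‖ := by
  have h := cdot_cconj_orthAct g z z
  rw [cdot_cconj_self, cdot_cconj_self] at h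
  have h2 : ‖orthAct g z‖ ^ 2 = ‖z‖ ^ 2 := by exact_mod_cast h
  exact (pow_left_inj₀ (norm_nonneg _) (norm_nonneg _) two_ne_zero).1 h2

lemma continuous_orthAct : Continuous fun p : OrthGroup n × Amb n => orthAct p.1 p.2 := by
  refine (PiLp.continuous_toLp 2 _).comp (continuous_pi fun i => ?_)
  refine continuous_finsetSum _ fun j _ => ?_
  refine (Complex.continuous_ofReal.comp ?_).mul (by fun_prop)
  exact (continuous_subtype_val.comp continuous_fst).matrix_elem i j

lemma differentiable_orthAct (g : OrthGroup n) : Differentiable ℂ (orthAct g : Amb n → Amb n) := by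
  rw [differentiable_piLp]
  intro i
  simp only [orthAct_apply]
  fun_prop

lemma orthAct_mem_keplerBall (g : OrthGroup n) {R : ℝ≥0∞} {z : Amb n} (hz : z ∈ keplerBall n R) :
    orthAct g z ∈ keplerBall n R := by
  obtain ⟨⟨h1, h2⟩, h3⟩ := hz
  refine ⟨⟨by rw [cdot_orthAct, h1], ?_⟩, by rwa [norm_orthAct]⟩
  rw [← norm_ne_zero_iff, norm_orthAct]
  exact norm_ne_zero_iff.2 h2

lemma measurableSet_keplerBall (R : ℝ≥0∞) : MeasurableSet (keplerBall n R) := by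
  refine MeasurableSet.inter (MeasurableSet.inter ?_ ?_) ?_
  · exact (isClosed_eq continuous_cdot_self continuous_const).measurableSet
  · exact isOpen_ne.measurableSet
  · exact measurableSet_lt (ENNReal.measurable_ofReal.comp measurable_norm) measurable_const

lemma cdot_basePoint_self : cdot (basePoint (m + 2)) (basePoint (m + 2)) = 0 := by
  simp [cdot, basePoint, Fin.sum_univ_succ, div_mul_div_comm]
  ring

lemma sqrt_two_mul_self : ((Real.sqrt 2 : ℝ) : ℂ) * (Real.sqrt 2 : ℝ) = 2 := by
  rw [← Complex.ofReal_mul, Real.mul_self_sqrt zero_le_two]; norm_num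

lemma sqrt_two_ne_zero : ((Real.sqrt 2 : ℝ) : ℂ) ≠ 0 := by simp

lemma cdot_basePoint_cconj : cdot (basePoint (m + 2)) (cconj (basePoint (m + 2))) = 1 := by
  simp [cdot, basePoint, Fin.sum_univ_succ, div_mul_div_comm, sqrt_two_mul_self]
  norm_num

lemma norm_basePoint : ‖basePoint (m + 2)‖ = 1 := by
  have h := cdot_cconj_self (basePoint (m + 2))
  rw [cdot_basePoint_cconj] at h
  have h2 : ‖basePoint (m + 2)‖ ^ 2 = 1 := by exact_mod_cast h.symm
  exact (pow_eq_one_iff_of_nonneg (norm_nonneg _) two_ne_zero).1 h2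

/-! ### Coordinates adapted to the base point -/

/-- The coordinate `w · conj e` along the base point `e`. -/
def coordA (w : Amb (m + 2)) : ℂ := cdot w (cconj (basePoint (m + 2)))

/-- The coordinate `w · e` along the conjugate of the base point `e`. -/
def coordB (w : Amb (m + 2)) : ℂ := cdot w (basePoint (m + 2))

lemma coordA_eq (w : Amb (m + 2)) : coordA w = (w 0 - Complex.I * w 1) / (Real.sqrt 2 : ℝ) := by
  simp [coordA, cdot, basePoint, Fin.sum_univ_succ]
  ring

lemma coordB_eq (w : Amb (m + 2)) : coordB w = (w 0 + Complex.I * w 1) / (Real.sqrt 2 : ℝ) := by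
  simp [coordB, cdot, basePoint, Fin.sum_univ_succ]
  ring

lemma cdot_self_eq (w : Amb (m + 2)) :
    cdot w w = 2 * coordA w * coordB w + ∑ j : Fin (m + 1), w j.succ.succ ^ 2 := by
  rw [coordA_eq, coordB_eq, cdot, Fin.sum_univ_succ, Fin.sum_univ_succ, ← add_assoc]
  congr 1
  · have : 2 * ((w 0 - Complex.I * w 1) / (Real.sqrt 2 : ℝ)) *
      ((w 0 + Complex.I * w 1) / (Real.sqrt 2 : ℝ)) = 2 * ((w 0 - Complex.I * w 1) *
      (w 0 + Complex.I * w 1)) / ((Real.sqrt 2 : ℝ) * (Real.sqrt 2 : ℝ)) := by ring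
    rw [this, sqrt_two_mul_self]
    ring_nf
    simp
  · simp [pow_two]

lemma norm_sq_eq (w : Amb (m + 2)) :
    ‖w‖ ^ 2 = ‖coordA w‖ ^ 2 + ‖coordB w‖ ^ 2 + ∑ j : Fin (m + 1), ‖w j.succ.succ‖ ^ 2 := by
  rw [EuclideanSpace.norm_sq_eq, Fin.sum_univ_succ, Fin.sum_univ_succ, ← add_assoc]
  congr 1
  rw [coordA_eq, coordB_eq, norm_div, norm_div, div_pow, div_pow]
  have h := parallelogram_law_with_norm ℝ (w 0) (Complex.I * w 1)
  have h1 : ‖Complex.I * w 1‖ = ‖w 1‖ := by simp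
  have h2 : ‖((Real.sqrt 2 : ℝ) : ℂ)‖ ^ 2 = 2 := by simp
  rw [h2]
  rw [h1] at h
  simp only [Fin.succ_zero_eq_one]
  nlinarith [h]

/-- The vector with prescribed coordinates. -/
def ofCoord (a b : ℂ) (v : Fin (m + 1) → ℂ) : Amb (m + 2) :=
  WithLp.toLp 2 (Fin.cons ((a + b) / (Real.sqrt 2 : ℝ))
    (Fin.cons (Complex.I * (a - b) / (Real.sqrt 2 : ℝ)) v))

lemma ofCoord_zero_apply (a b : ℂ) (v : Fin (m + 1) → ℂ) :
    ofCoord a b v 0 = (a + b) / (Real.sqrt 2 : ℝ) := rfl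

lemma ofCoord_one_apply (a b : ℂ) (v : Fin (m + 1) → ℂ) :
    ofCoord a b v 1 = Complex.I * (a - b) / (Real.sqrt 2 : ℝ) := rfl

@[simp] lemma ofCoord_succ_succ_apply (a b : ℂ) (v : Fin (m + 1) → ℂ) (j : Fin (m + 1)) :
    ofCoord a b v j.succ.succ = v j := rfl

@[simp] lemma coordA_ofCoord (a b : ℂ) (v : Fin (m + 1) → ℂ) : coordA (ofCoord a b v) = a := by
  rw [coordA_eq, ofCoord_zero_apply, ofCoord_one_apply]
  have h := sqrt_two_mul_self
  have h0 := sqrt_two_ne_zero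
  field_simp
  rw [pow_two ((Real.sqrt 2 : ℝ) : ℂ), h]
  ring_nf
  simp
  ring

@[simp] lemma coordB_ofCoord (a b : ℂ) (v : Fin (m + 1) → ℂ) : coordB (ofCoord a b v) = b := by
  rw [coordB_eq, ofCoord_zero_apply, ofCoord_one_apply]
  have h := sqrt_two_mul_self
  have h0 := sqrt_two_ne_zero
  field_simp
  rw [pow_two ((Real.sqrt 2 : ℝ) : ℂ), h]
  ring_nf
  simp
  ring

lemma continuous_ofCoord {X : Type*} [TopologicalSpace X] {a b : X → ℂ} {v : X → Fin (m + 1) → ℂ}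
    (ha : Continuous a) (hb : Continuous b) (hv : ∀ j, Continuous fun x => v x j) :
    Continuous fun x => ofCoord (a x) (b x) (v x) := by
  refine (PiLp.continuous_toLp 2 _).comp (continuous_pi fun i => ?_)
  refine Fin.cases ?_ (fun i => Fin.cases ?_ (fun j => ?_) i) i
  · simp only [Fin.cons_zero]; fun_prop
  · simp only [Fin.cons_succ, Fin.cons_zero]; fun_prop
  · simp only [Fin.cons_succ]; exact hv j

lemma differentiable_ofCoord {a b : ℂ → ℂ} {v : ℂ → Fin (m + 1) → ℂ}
    (ha : Differentiable ℂ a) (hb : Differentiable ℂ b)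
    (hv : ∀ j, Differentiable ℂ fun x => v x j) :
    Differentiable ℂ fun x => ofCoord (a x) (b x) (v x) := by
  rw [differentiable_piLp]
  intro i
  refine Fin.cases ?_ (fun i => Fin.cases ?_ (fun j => ?_) i) i
  · simp only [ofCoord_zero_apply]; fun_prop
  · simp only [Fin.succ_zero_eq_one, ofCoord_one_apply]; fun_prop
  · simp only [ofCoord_succ_succ_apply]; exact hv j

/-! ### The contracting flow on the cone. -/

/-- The holomorphic flow `φ_t` fixing `coordA` and contracting the Kepler manifold. -/
def flow (t : ℂ) (w : Amb (m + 2)) : Amb (m + 2) :=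
  ofCoord (coordA w) (t ^ 2 * coordB w) fun j => t * w j.succ.succ

@[simp] lemma flow_succ_succ_apply (t : ℂ) (w : Amb (m + 2)) (j : Fin (m + 1)) :
    flow t w j.succ.succ = t * w j.succ.succ := rfl

@[simp] lemma coordA_flow (t : ℂ) (w : Amb (m + 2)) : coordA (flow t w) = coordA w :=
  coordA_ofCoord _ _ _

@[simp] lemma coordB_flow (t : ℂ) (w : Amb (m + 2)) : coordB (flow t w) = t ^ 2 * coordB w :=
  coordB_ofCoord _ _ _

lemma ext_coord {v w : Amb (m + 2)} (hA : coordA v = coordA w) (hB : coordB v = coordB w)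
    (hj : ∀ j : Fin (m + 1), v j.succ.succ = w j.succ.succ) : v = w := by
  rw [coordA_eq, coordA_eq, div_left_inj' sqrt_two_ne_zero] at hA
  rw [coordB_eq, coordB_eq, div_left_inj' sqrt_two_ne_zero] at hB
  ext i
  refine Fin.cases ?_ (fun i => Fin.cases ?_ (fun j => ?_) i) i
  · linear_combination (hA + hB) / 2
  · have h : Complex.I * (v 1 - w 1) = 0 := by linear_combination (hB - hA) / 2
    have h2 := (mul_eq_zero.1 h).resolve_left Complex.I_ne_zero
    exact sub_eq_zero.1 h2
  · exact hj j

/-- The weights `0`, `2`, `1` of `a`, `b`, `w_j` are chosen so that `2ab` and `w_j²` both scale by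
`t²`. -/
lemma cdot_flow_self (t : ℂ) (w : Amb (m + 2)) : cdot (flow t w) (flow t w) = t ^ 2 * cdot w w := by
  rw [cdot_self_eq, cdot_self_eq w]
  simp only [coordA_flow, coordB_flow, flow_succ_succ_apply, mul_pow, ← Finset.mul_sum]
  ring

lemma norm_flow_le {t : ℂ} (ht : ‖t‖ ≤ 1) (w : Amb (m + 2)) : ‖flow t w‖ ≤ ‖w‖ := by
  refine (pow_le_pow_iff_left₀ (norm_nonneg _) (norm_nonneg _) two_ne_zero).1 ?_
  rw [norm_sq_eq, norm_sq_eq w]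
  simp only [coordA_flow, coordB_flow, flow_succ_succ_apply, norm_mul, norm_pow]
  gcongr
  · exact mul_le_of_le_one_left (norm_nonneg _) (pow_le_one₀ (norm_nonneg _) ht)
  · exact mul_le_of_le_one_left (norm_nonneg _) ht

lemma norm_flow {t : ℂ} (ht : ‖t‖ = 1) (w : Amb (m + 2)) : ‖flow t w‖ = ‖w‖ := by
  refine (pow_left_inj₀ (norm_nonneg _) (norm_nonneg _) two_ne_zero).1 ?_
  rw [norm_sq_eq, norm_sq_eq w]
  simp [ht]

lemma coordA_smul (c : ℂ) (w : Amb (m + 2)) : coordA (c • w) = c * coordA w :=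
  cdot_smul_left _ _ _

lemma coordB_smul (c : ℂ) (w : Amb (m + 2)) : coordB (c • w) = c * coordB w :=
  cdot_smul_left _ _ _

@[simp] lemma coordA_basePoint : coordA (basePoint (m + 2)) = 1 := cdot_basePoint_cconj

@[simp] lemma coordB_basePoint : coordB (basePoint (m + 2)) = 0 := cdot_basePoint_self

@[simp] lemma basePoint_succ_succ (j : Fin (m + 1)) : basePoint (m + 2) j.succ.succ = 0 := by
  simp [basePoint]

lemma flow_zero (w : Amb (m + 2)) : flow 0 w = coordA w • basePoint (m + 2) := by
  refine ext_coord ?_ ?_ fun j => ?_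
  · simp [coordA_smul]
  · simp [coordB_smul]
  · simp

/-- The flow keeps `coordA` fixed, so a nonzero value prevents it from reaching the vertex, even at
`t = 0`. -/
lemma flow_mem_keplerBall {R : ℝ≥0∞} {w : Amb (m + 2)} (hw : w ∈ keplerBall (m + 2) R)
    (ha : coordA w ≠ 0) {t : ℂ} (ht : ‖t‖ ≤ 1) : flow t w ∈ keplerBall (m + 2) R := by
  refine ⟨⟨by rw [cdot_flow_self, hw.1.1, mul_zero], fun h => ha ?_⟩, ?_⟩
  · rw [← coordA_flow t w, h]
    simp [coordA, cdot]
  · exact lt_of_le_of_lt (ENNReal.ofReal_le_ofReal (norm_flow_le ht w)) hw.2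

lemma continuous_coordA : Continuous (coordA : Amb (m + 2) → ℂ) := continuous_cdot_left _

lemma continuous_coordB : Continuous (coordB : Amb (m + 2) → ℂ) := continuous_cdot_left _

lemma continuous_flow : Continuous fun p : ℂ × Amb (m + 2) => flow p.1 p.2 := by
  have hA := continuous_coordA (m := m)
  have hB := continuous_coordB (m := m)
  exact continuous_ofCoord (by fun_prop) (by fun_prop) fun j => by fun_prop

lemma differentiable_flow (w : Amb (m + 2)) : Differentiable ℂ fun t : ℂ => flow t w :=
  differentiable_ofCoord (by fun_prop) (by fun_prop) fun j => by fun_prop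

end

section

variable {n m : ℕ}

/-! ### Rotations in coordinate planes -/

/-- The rotation by the angle `θ` in the plane of the coordinates `i ≠ j`. -/
def planeRot {i j : Fin (n + 1)} (hij : i ≠ j) (θ : ℝ) : OrthGroup n :=
  ⟨1 + (Real.cos θ - 1) • (Matrix.single i i 1 + Matrix.single j j 1) +
    Real.sin θ • (Matrix.single i j 1 - Matrix.single j i 1), by
    rw [Matrix.mem_orthogonalGroup_iff]
    -- `P` projects onto the coordinate plane and `Q` is its infinitesimal rotation, so `P² = P`,
    -- `PQ = QP = Q`, `Q² = -P`; orthogonality then reduces to `sin² + cos² = 1`.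
    set P : Matrix (Fin (n + 1)) (Fin (n + 1)) ℝ := Matrix.single i i 1 + Matrix.single j j 1
    set Q : Matrix (Fin (n + 1)) (Fin (n + 1)) ℝ := Matrix.single i j 1 - Matrix.single j i 1
    have hP : P.transpose = P := by simp [P]
    have hQ : Q.transpose = -Q := by simp [Q]
    have hPP : P * P = P := by
      simp [P, mul_add, add_mul, Matrix.single_mul_single_of_ne, hij, hij.symm]
    have hPQ : P * Q = Q := by
      simp only [P, Q, mul_sub, add_mul]
      simp [Matrix.single_mul_single_of_ne, hij, hij.symm, sub_eq_add_neg]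
    have hQP : Q * P = Q := by
      simp [P, Q, mul_add, sub_mul, Matrix.single_mul_single_of_ne, hij, hij.symm]
      abel
    have hQQ : Q * Q = -P := by
      simp [P, Q, mul_sub, sub_mul, Matrix.single_mul_single_of_ne, hij, hij.symm]
      abel
    have h := Real.sin_sq_add_cos_sq θ
    have hstar : (1 + (Real.cos θ - 1) • P + Real.sin θ • Q).transpose =
        1 + (Real.cos θ - 1) • P - Real.sin θ • Q := by
      rw [Matrix.transpose_add, Matrix.transpose_add, Matrix.transpose_smul, Matrix.transpose_smul,
        hP, hQ, Matrix.transpose_one, smul_neg, ← sub_eq_add_neg]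
    change _ * (1 + (Real.cos θ - 1) • P + Real.sin θ • Q).transpose = 1
    rw [hstar]
    simp only [mul_add, add_mul, mul_sub, one_mul,
      mul_one, smul_mul_assoc, mul_smul_comm, hPP, hPQ, hQP, hQQ, smul_neg]
    match_scalars <;> first | ring1 | linear_combination h⟩

lemma orthAct_planeRot_apply {i j : Fin (n + 1)} (hij : i ≠ j) (θ : ℝ) (w : Amb n)
    (k : Fin (n + 1)) : orthAct (planeRot hij θ) w k = w k +
      (if k = i then ((Real.cos θ : ℂ) - 1) * w i + Real.sin θ * w j else 0) +
      (if k = j then ((Real.cos θ : ℂ) - 1) * w j - Real.sin θ * w i else 0) := by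
  have h : ∀ l, ((planeRot hij θ : Matrix (Fin (n + 1)) (Fin (n + 1)) ℝ) k l) =
      (if k = l then 1 else 0) + ((Real.cos θ - 1) * ((if i = k ∧ i = l then 1 else 0) +
        (if j = k ∧ j = l then 1 else 0)) + Real.sin θ * ((if i = k ∧ j = l then 1 else 0) -
        (if j = k ∧ i = l then 1 else 0))) := by
    intro l
    simp only [planeRot, Matrix.add_apply, Matrix.sub_apply, Matrix.smul_apply, Matrix.one_apply,
      Matrix.single_apply, smul_eq_mul, add_assoc]
  simp only [orthAct_apply, h]
  push_cast
  simp only [apply_ite Complex.ofReal, Complex.ofReal_one, Complex.ofReal_zero, ite_and, add_mul,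
    mul_add, sub_mul, mul_sub, Finset.sum_add_distrib, Finset.sum_sub_distrib, mul_ite, ite_mul,
    mul_one, mul_zero, zero_mul, one_mul, Finset.sum_ite_irrel, Finset.sum_ite_eq,
    Finset.mem_univ, if_true, Finset.sum_const_zero, eq_comm (a := i) (b := k),
    eq_comm (a := j) (b := k)]
  by_cases h1 : k = i
  · have h2 : k ≠ j := fun h => hij (h1.symm.trans h)
    simp [h1, hij]
  · by_cases h2 : k = j
    · simp [h2, hij.symm, ← sub_eq_add_neg]
    · simp [h1, h2]

lemma orthAct_planeRot_fst {i j : Fin (n + 1)} (hij : i ≠ j) (θ : ℝ) (w : Amb n) :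
    orthAct (planeRot hij θ) w i = Real.cos θ * w i + Real.sin θ * w j := by
  rw [orthAct_planeRot_apply, if_pos rfl, if_neg hij]
  ring

lemma orthAct_planeRot_snd {i j : Fin (n + 1)} (hij : i ≠ j) (θ : ℝ) (w : Amb n) :
    orthAct (planeRot hij θ) w j = Real.cos θ * w j - Real.sin θ * w i := by
  rw [orthAct_planeRot_apply, if_pos rfl, if_neg hij.symm]
  ring

lemma orthAct_planeRot_of_ne {i j k : Fin (n + 1)} (hij : i ≠ j) (hi : k ≠ i) (hj : k ≠ j) (θ : ℝ)
    (w : Amb n) : orthAct (planeRot hij θ) w k = w k := by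
  rw [orthAct_planeRot_apply, if_neg hi, if_neg hj]
  ring

lemma zero_ne_one_fin : (0 : Fin (m + 2 + 1)) ≠ 1 := by simp

lemma coordA_planeRot (θ : ℝ) (w : Amb (m + 2)) :
    coordA (orthAct (planeRot zero_ne_one_fin θ) w) = Complex.exp (θ * Complex.I) * coordA w := by
  rw [coordA_eq, coordA_eq, orthAct_planeRot_fst, orthAct_planeRot_snd, Complex.exp_mul_I,
    Complex.ofReal_cos, Complex.ofReal_sin]
  ring_nf
  simp

lemma coordB_planeRot (θ : ℝ) (w : Amb (m + 2)) :
    coordB (orthAct (planeRot zero_ne_one_fin θ) w) = Complex.exp (-(θ * Complex.I)) * coordB w := by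
  rw [coordB_eq, coordB_eq, orthAct_planeRot_fst, orthAct_planeRot_snd, ← neg_mul,
    Complex.exp_mul_I,
    Complex.ofReal_cos, Complex.ofReal_sin, Complex.cos_neg, Complex.sin_neg]
  ring_nf
  simp

lemma planeRot_succ_succ (θ : ℝ) (w : Amb (m + 2)) (j : Fin (m + 1)) :
    orthAct (planeRot zero_ne_one_fin θ) w j.succ.succ = w j.succ.succ :=
  orthAct_planeRot_of_ne _ (Fin.succ_ne_zero _)
    (by rw [← Fin.succ_zero_eq_one, Ne, Fin.succ_inj]; exact Fin.succ_ne_zero _) θ w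

/-- The base point is an eigenvector of the rotations in its own plane. Unimodular scalars therefore
act on its orbit through right multiplication in the group. -/
lemma planeRot_basePoint (θ : ℝ) : orthAct (planeRot zero_ne_one_fin θ) (basePoint (m + 2)) =
    Complex.exp (θ * Complex.I) • basePoint (m + 2) := by
  refine ext_coord ?_ ?_ fun j => ?_
  · rw [coordA_planeRot, coordA_smul]
  · rw [coordB_planeRot, coordB_smul]; simp
  · rw [planeRot_succ_succ]; simp

/-- The rotation by `-θ` has weights `-1`, `1`, `0` on `a`, `b`, `w_j`; the scalar raises each by
one, which gives the weights of the flow. -/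
lemma flow_exp (θ : ℝ) (w : Amb (m + 2)) : flow (Complex.exp (θ * Complex.I)) w =
    Complex.exp (θ * Complex.I) • orthAct (planeRot zero_ne_one_fin (-θ)) w := by
  refine ext_coord ?_ ?_ fun j => ?_
  · rw [coordA_flow, coordA_smul, coordA_planeRot, ← mul_assoc, ← Complex.exp_add]
    simp
  · rw [coordB_flow, coordB_smul, coordB_planeRot, ← mul_assoc, pow_two]
    simp
  · rw [flow_succ_succ_apply, PiLp.smul_apply, planeRot_succ_succ, smul_eq_mul]

lemma exists_exp_of_norm_eq_one {c : ℂ} (hc : ‖c‖ = 1) :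
    ∃ θ : ℝ, c = Complex.exp (θ * Complex.I) := by
  refine ⟨c.arg, ?_⟩
  have h := Complex.norm_mul_exp_arg_mul_I c
  rw [hc] at h
  simpa using h.symm

/-! ### Transitivity -/

/-- Write `z = (x + i y) / √2` with `x`, `y` real. The two hypotheses say exactly that `x`, `y` are
orthonormal; an orthonormal basis extending them supplies the columns of `g`. -/
lemma exists_orthAct_basePoint_eq {z : Amb (m + 2)} (hz : cdot z z = 0) (hz1 : ‖z‖ = 1) :
    ∃ g : OrthGroup (m + 2), orthAct g (basePoint (m + 2)) = z := by
  set x : EuclideanSpace ℝ (Fin (m + 2 + 1)) := WithLp.toLp 2 fun i => Real.sqrt 2 * (z i).re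
  set y : EuclideanSpace ℝ (Fin (m + 2 + 1)) := WithLp.toLp 2 fun i => Real.sqrt 2 * (z i).im
  have hs : Real.sqrt 2 * Real.sqrt 2 = 2 := Real.mul_self_sqrt zero_le_two
  have hre : ∑ i, ((z i).re * (z i).re - (z i).im * (z i).im) = 0 := by
    simpa [cdot] using congrArg Complex.re hz
  have him : ∑ i, ((z i).re * (z i).im + (z i).im * (z i).re) = 0 := by
    simpa [cdot] using congrArg Complex.im hz
  have hno : ∑ i, ((z i).re * (z i).re + (z i).im * (z i).im) = 1 := by
    have h := EuclideanSpace.norm_sq_eq z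
    rw [hz1] at h
    simpa [← Complex.normSq_eq_norm_sq, Complex.normSq_apply] using h.symm
  rw [Finset.sum_sub_distrib] at hre
  rw [Finset.sum_add_distrib] at him hno
  have hxx : inner ℝ x x = 1 := by
    simp only [x, PiLp.inner_apply, RCLike.inner_apply, conj_trivial]
    calc ∑ i, (Real.sqrt 2 * (z i).re) * (Real.sqrt 2 * (z i).re)
        = 2 * ∑ i, (z i).re * (z i).re := by
          rw [Finset.mul_sum]; exact Finset.sum_congr rfl fun i _ => by linear_combination (z i).re * (z i).re * hs
      _ = 1 := by linarith
  have hyy : inner ℝ y y = 1 := by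
    simp only [y, PiLp.inner_apply, RCLike.inner_apply, conj_trivial]
    calc ∑ i, (Real.sqrt 2 * (z i).im) * (Real.sqrt 2 * (z i).im)
        = 2 * ∑ i, (z i).im * (z i).im := by
          rw [Finset.mul_sum]; exact Finset.sum_congr rfl fun i _ => by linear_combination (z i).im * (z i).im * hs
      _ = 1 := by linarith
  have hyx : inner ℝ y x = 0 := by
    simp only [x, y, PiLp.inner_apply, RCLike.inner_apply, conj_trivial]
    calc ∑ i, (Real.sqrt 2 * (z i).re) * (Real.sqrt 2 * (z i).im)
        = ∑ i, (z i).re * (z i).im + ∑ i, (z i).im * (z i).re := by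
          rw [← Finset.sum_add_distrib]
          exact Finset.sum_congr rfl fun i _ => by linear_combination (z i).re * (z i).im * hs
      _ = 0 := him
  have hxy : inner ℝ x y = 0 := by rw [real_inner_comm, hyx]
  have hv : Orthonormal ℝ (({0, 1} : Set (Fin (m + 2 + 1))).domRestrict
      fun i => if i = 0 then x else y) := by
    rw [orthonormal_iff_ite]
    rintro ⟨i, hi⟩ ⟨j, hj⟩
    rcases hi with rfl | rfl <;> rcases hj with rfl | rfl <;>
      simp only [Set.domRestrict_apply, if_true, one_ne_zero, if_false, hxx, hyy, hxy, hyx] <;>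
      exact (if_neg fun h => by simpa using congrArg Subtype.val h).symm
  obtain ⟨b, hb⟩ := hv.exists_orthonormalBasis_extension_of_card_eq (by simp)
  have hb0 : b 0 = x := by simpa using hb 0 (by simp)
  have hb1 : b 1 = y := by simpa using hb 1 (by simp)
  have hg : (Matrix.of fun i k => b k i : Matrix (Fin (m + 2 + 1)) (Fin (m + 2 + 1)) ℝ) ∈
      Matrix.orthogonalGroup (Fin (m + 2 + 1)) ℝ := by
    rw [Matrix.mem_orthogonalGroup_iff']
    ext k l
    have := orthonormal_iff_ite.1 b.orthonormal l k
    simp only [PiLp.inner_apply, RCLike.inner_apply, conj_trivial] at this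
    simp [Matrix.mul_apply, Matrix.one_apply, this, eq_comm]
  refine ⟨⟨_, hg⟩, ?_⟩
  ext i
  have hsc := sqrt_two_ne_zero
  simp only [orthAct_apply, Matrix.of_apply]
  rw [Fin.sum_univ_succ, Fin.sum_univ_succ]
  simp only [Fin.succ_zero_eq_one, basePoint_succ_succ, hb0, hb1, mul_zero,
    Finset.sum_const_zero, add_zero]
  simp only [x, y, basePoint, Fin.val_zero, Fin.val_one, if_true, one_ne_zero, if_false]
  push_cast
  field_simp
  exact Complex.re_add_im _

lemma exists_smul_orthAct_basePoint {z : Amb (m + 2)} (hz : z ∈ keplerManifold (m + 2)) :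
    ∃ g : OrthGroup (m + 2), z = orthAct g ((‖z‖ : ℂ) • basePoint (m + 2)) := by
  have h0 : (‖z‖ : ℂ) ≠ 0 := by simpa using hz.2
  obtain ⟨g, hg⟩ := exists_orthAct_basePoint_eq (z := (‖z‖ : ℂ)⁻¹ • z)
    (by rw [cdot_smul_left, cdot_smul_right, hz.1]; simp)
    (by rw [norm_smul, norm_inv, Complex.norm_real, norm_norm,
          inv_mul_cancel₀ (by simpa using hz.2)])
  exact ⟨g, by rw [orthAct_smul, hg, smul_smul, mul_inv_cancel₀ h0, one_smul]⟩

/-! ### Invariance of the measures -/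

/-- The normalized Haar measure of the orthogonal group. -/
abbrev orthHaar (n : ℕ) : Measure (OrthGroup n) :=
  Measure.haarMeasure (⊤ : TopologicalSpace.PositiveCompacts (OrthGroup n))

instance instIsProbabilityMeasureOrthHaar : IsProbabilityMeasure (orthHaar n) :=
  ⟨by simpa using Measure.haarMeasure_self (K₀ := (⊤ : TopologicalSpace.PositiveCompacts (OrthGroup n)))⟩

/-- A compact group is unimodular: the image of Haar measure under a right translation is left
invariant, hence a multiple of it, and the total masses agree. -/
instance instIsMulRightInvariantOrthHaar : (orthHaar n).IsMulRightInvariant where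
  map_mul_right_eq_self g := by
    have hm : Measurable fun x : OrthGroup n => x * g := (continuous_mul_const g).measurable
    have hp : IsProbabilityMeasure (Measure.map (· * g) (orthHaar n)) :=
      Measure.isProbabilityMeasure_map hm.aemeasurable
    have h := Measure.isMulInvariant_eq_smul_of_compactSpace
      (Measure.map (· * g) (orthHaar n)) (orthHaar n)
    have h1 := congrArg (fun ν => ν Set.univ) h
    simp only [Measure.smul_apply, measure_univ] at h1
    rw [h]
    ext s _
    rw [Measure.smul_apply, ENNReal.smul_def, smul_eq_mul]
    rw [ENNReal.smul_def, smul_eq_mul, mul_one] at h1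
    rw [← h1, one_mul]

lemma continuous_orbit (z : Amb n) : Continuous fun g : OrthGroup n => orthAct g z :=
  continuous_orthAct.comp (continuous_id.prodMk continuous_const)

lemma continuous_orthAct_right (g : OrthGroup n) : Continuous (orthAct g : Amb n → Amb n) :=
  continuous_orthAct.comp (continuous_const.prodMk continuous_id)

lemma sphereMeasure_eq : sphereMeasure n =
    Measure.map (fun g : OrthGroup n => orthAct g (basePoint n)) (orthHaar n) := rfl

instance instIsProbabilityMeasureSphere : IsProbabilityMeasure (sphereMeasure n) :=
  Measure.isProbabilityMeasure_map (continuous_orbit _).measurable.aemeasurable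

lemma measurePreserving_orthAct_sphere (h : OrthGroup n) :
    MeasurePreserving (orthAct h) (sphereMeasure n) (sphereMeasure n) := by
  refine ⟨(continuous_orthAct_right h).measurable, ?_⟩
  rw [sphereMeasure_eq]
  rw [Measure.map_map (continuous_orthAct_right h).measurable (continuous_orbit _).measurable]
  nth_rewrite 2 [← map_mul_left_eq_self (orthHaar n) h]
  rw [Measure.map_map (continuous_orbit _).measurable (continuous_const_mul h).measurable]
  congr 1
  ext1 g
  simp [orthAct_mul]

/-- The scalar is a right translation on the orbit of the base point (`planeRot_basePoint`), so
right invariance of Haar measure applies. -/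
lemma measurePreserving_smul_sphere {c : ℂ} (hc : ‖c‖ = 1) :
    MeasurePreserving (fun w : Amb (m + 2) => c • w) (sphereMeasure (m + 2))
      (sphereMeasure (m + 2)) := by
  obtain ⟨θ, rfl⟩ := exists_exp_of_norm_eq_one hc
  have hm : Measurable fun w : Amb (m + 2) => Complex.exp (θ * Complex.I) • w :=
    (continuous_const_smul _).measurable
  refine ⟨hm, ?_⟩
  rw [sphereMeasure_eq]
  rw [Measure.map_map hm (continuous_orbit _).measurable]
  nth_rewrite 2 [← map_mul_right_eq_self (orthHaar (m + 2)) (planeRot zero_ne_one_fin θ)]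
  rw [Measure.map_map (continuous_orbit _).measurable (continuous_mul_const _).measurable]
  congr 1
  ext1 g
  simp [orthAct_mul, planeRot_basePoint, orthAct_smul]

lemma ae_sphere : ∀ᵐ w ∂(sphereMeasure (m + 2)), cdot w w = 0 ∧ ‖w‖ = 1 := by
  refine (ae_map_iff (continuous_orbit _).measurable.aemeasurable ?_).2
    (Filter.Eventually.of_forall fun g => ?_)
  · exact ((isClosed_eq continuous_cdot_self continuous_const).inter
      (isClosed_eq continuous_norm continuous_const)).measurableSet
  · rw [cdot_orthAct, norm_orthAct]
    exact ⟨cdot_basePoint_self, norm_basePoint⟩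

/-- Scaling, as a map from the product. -/
lemma measurable_scale : Measurable fun p : ℝ × Amb n => ((p.1 : ℝ) : ℂ) • p.2 :=
  Continuous.measurable (by fun_prop)

variable (ρ : Measure ℝ)

/-- Almost every `t` lies in the support, hence below or at the supremum, and the supremum itself
carries no mass. -/
lemma ae_lt_radius (hρ : ρ (Set.Iic 0) = 0)
    (hR : ∀ t : ℝ, radius ρ = ENNReal.ofReal t → ρ {t} = 0) :
    ∀ᵐ t ∂ρ, 0 < t ∧ ENNReal.ofReal t < radius ρ := by
  have h1 : ∀ᵐ t ∂ρ, 0 < t := by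
    rw [ae_iff]
    simpa [Set.Iic_def] using hρ
  have h2 : ∀ᵐ t ∂ρ, 0 < t → ENNReal.ofReal t ≠ radius ρ := by
    by_cases h : ∃ t : ℝ, 0 < t ∧ ENNReal.ofReal t = radius ρ
    · obtain ⟨t, ht, htR⟩ := h
      have := hR t htR.symm
      filter_upwards [compl_mem_ae_iff.2 this] with s hs hs0 hsR
      rw [← htR, ENNReal.ofReal_eq_ofReal_iff hs0.le ht.le] at hsR
      exact hs hsR
    · push Not at h
      exact Filter.Eventually.of_forall fun t ht => h t ht
  filter_upwards [h1, h2, Measure.support_mem_ae (μ := ρ)] with t ht0 htR hts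
  exact ⟨ht0, lt_of_le_of_ne (le_sSup ⟨t, ⟨ht0, hts⟩, rfl⟩) (htR ht0)⟩

lemma ae_rot {p : Amb n → Prop} (hp : MeasurableSet {w | p w})
    (h : ∀ᵐ (t : ℝ) ∂ρ, ∀ᵐ w ∂(sphereMeasure n), p ((t : ℂ) • w)) : ∀ᵐ w ∂(rotMeasure n ρ), p w := by
  refine (ae_map_iff measurable_scale.aemeasurable hp).2 ?_
  exact (Measure.ae_prod_iff_ae_ae (measurable_scale hp)).2 h

lemma ae_mem_keplerBall (hρ : ρ (Set.Iic 0) = 0)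
    (hR : ∀ t : ℝ, radius ρ = ENNReal.ofReal t → ρ {t} = 0) :
    ∀ᵐ w ∂(rotMeasure (m + 2) ρ), w ∈ keplerBall (m + 2) (radius ρ) := by
  refine ae_rot ρ (measurableSet_keplerBall _) ?_
  filter_upwards [ae_lt_radius ρ hρ hR] with t ht
  filter_upwards [ae_sphere] with w hw
  refine ⟨⟨by rw [cdot_smul_left, cdot_smul_right, hw.1]; simp, ?_⟩, ?_⟩
  · rw [← norm_ne_zero_iff, norm_smul, hw.2]
    simpa using ht.1.ne'
  · rw [norm_smul, hw.2, Complex.norm_real, Real.norm_of_nonneg ht.1.le, mul_one]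
    exact ht.2

variable [IsFiniteMeasure ρ]

instance instIsFiniteMeasureRot : IsFiniteMeasure (rotMeasure n ρ) := by
  unfold rotMeasure; infer_instance

lemma measurePreserving_rot {T : Amb n → Amb n}
    (hT : MeasurePreserving T (sphereMeasure n) (sphereMeasure n))
    (hs : ∀ (t : ℝ) w, T ((t : ℂ) • w) = (t : ℂ) • T w) :
    MeasurePreserving T (rotMeasure n ρ) (rotMeasure n ρ) := by
  refine ⟨hT.measurable, ?_⟩
  unfold rotMeasure
  have hp := (MeasurePreserving.id ρ).prod hT
  rw [Measure.map_map hT.measurable measurable_scale]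
  nth_rewrite 2 [← hp.map_eq]
  rw [Measure.map_map measurable_scale hp.measurable]
  congr 1
  ext1 p
  exact hs p.1 p.2

lemma measurePreserving_orthAct_rot (h : OrthGroup n) :
    MeasurePreserving (orthAct h) (rotMeasure n ρ) (rotMeasure n ρ) :=
  measurePreserving_rot ρ (measurePreserving_orthAct_sphere h) fun _ _ => orthAct_smul _ _ _

lemma measurePreserving_smul_rot {c : ℂ} (hc : ‖c‖ = 1) :
    MeasurePreserving (fun w : Amb (m + 2) => c • w) (rotMeasure (m + 2) ρ)
      (rotMeasure (m + 2) ρ) :=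
  measurePreserving_rot ρ (measurePreserving_smul_sphere hc) fun _ _ => smul_comm _ _ _

end

section

variable {n m : ℕ}

/-! ### Infinitesimal rotations -/

lemma orthAct_planeRot_add {i j : Fin (n + 1)} (hij : i ≠ j) (θ s : ℝ) (w : Amb n) :
    orthAct (planeRot hij (θ + s)) w = orthAct (planeRot hij s) (orthAct (planeRot hij θ) w) := by
  ext k
  by_cases hi : k = i
  · subst hi
    simp only [orthAct_planeRot_fst, orthAct_planeRot_snd, Real.cos_add, Real.sin_add]
    push_cast
    ring
  · by_cases hj : k = j
    · subst hj
      simp only [orthAct_planeRot_fst, orthAct_planeRot_snd, Real.cos_add, Real.sin_add]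
      push_cast
      ring
    · simp only [orthAct_planeRot_of_ne hij hi hj]

lemma orthAct_planeRot_zero {i j : Fin (n + 1)} (hij : i ≠ j) (w : Amb n) :
    orthAct (planeRot hij 0) w = w := by
  ext k
  rw [orthAct_planeRot_apply]
  simp

/-- `ψ` is the derivative of `φ` along the rotations in the plane of the coordinates `i`, `j`. -/
structure HasRotDeriv {i j : Fin (n + 1)} (hij : i ≠ j) (φ ψ : Amb n → ℂ) : Prop where
  cont : Continuous φ
  cont_deriv : Continuous ψ
  hasDerivAt : ∀ w, HasDerivAt (fun θ : ℝ => φ (orthAct (planeRot hij θ) w)) (ψ w) 0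

namespace HasRotDeriv

variable {i j : Fin (n + 1)} {hij : i ≠ j} {φ ψ φ' ψ' : Amb n → ℂ}

lemma fst : HasRotDeriv hij (fun w => w i) (fun w => w j) := by
  refine ⟨continuous_apply_amb i, continuous_apply_amb j, fun w => ?_⟩
  simp only [orthAct_planeRot_fst]
  have h := ((Real.hasDerivAt_cos 0).ofReal_comp.mul_const (w i)).fun_add
    ((Real.hasDerivAt_sin 0).ofReal_comp.mul_const (w j))
  simpa using h

lemma snd : HasRotDeriv hij (fun w => w j) (fun w => -w i) := by
  refine ⟨continuous_apply_amb j, (continuous_apply_amb i).neg, fun w => ?_⟩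
  simp only [orthAct_planeRot_snd]
  have h := ((Real.hasDerivAt_cos 0).ofReal_comp.mul_const (w j)).fun_sub
    ((Real.hasDerivAt_sin 0).ofReal_comp.mul_const (w i))
  simpa using h

lemma of_ne {k : Fin (n + 1)} (hi : k ≠ i) (hj : k ≠ j) :
    HasRotDeriv hij (fun w => w k) (fun _ => 0) := by
  refine ⟨continuous_apply_amb k, continuous_const, fun w => ?_⟩
  simp only [orthAct_planeRot_of_ne hij hi hj]
  exact hasDerivAt_const _ _

lemma add (h : HasRotDeriv hij φ ψ) (h' : HasRotDeriv hij φ' ψ') :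
    HasRotDeriv hij (fun w => φ w + φ' w) (fun w => ψ w + ψ' w) :=
  ⟨h.cont.add h'.cont, h.cont_deriv.add h'.cont_deriv,
    fun w => (h.hasDerivAt w).add (h'.hasDerivAt w)⟩

lemma const_mul (c : ℂ) (h : HasRotDeriv hij φ ψ) :
    HasRotDeriv hij (fun w => c * φ w) (fun w => c * ψ w) :=
  ⟨continuous_const.mul h.cont, continuous_const.mul h.cont_deriv,
    fun w => (h.hasDerivAt w).const_mul c⟩

lemma mul (h : HasRotDeriv hij φ ψ) (h' : HasRotDeriv hij φ' ψ') :
    HasRotDeriv hij (fun w => φ w * φ' w) (fun w => ψ w * φ' w + φ w * ψ' w) := by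
  refine ⟨h.cont.mul h'.cont, (h.cont_deriv.mul h'.cont).add (h.cont.mul h'.cont_deriv),
    fun w => ?_⟩
  have := (h.hasDerivAt w).fun_mul (h'.hasDerivAt w)
  simpa only [orthAct_planeRot_zero] using this

lemma pow (h : HasRotDeriv hij φ ψ) (k : ℕ) :
    HasRotDeriv hij (fun w => φ w ^ k) (fun w => k * φ w ^ (k - 1) * ψ w) := by
  refine ⟨h.cont.pow k, (continuous_const.mul (h.cont.pow _)).mul h.cont_deriv, fun w => ?_⟩
  have := (h.hasDerivAt w).fun_pow k
  simpa only [orthAct_planeRot_zero] using this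

lemma conj (h : HasRotDeriv hij φ ψ) :
    HasRotDeriv hij (fun w => (starRingEnd ℂ) (φ w)) (fun w => (starRingEnd ℂ) (ψ w)) :=
  ⟨Complex.continuous_conj.comp h.cont, Complex.continuous_conj.comp h.cont_deriv,
    fun w => (h.hasDerivAt w).star⟩

end HasRotDeriv

lemma integrable_sphere {φ : Amb (m + 2) → ℂ} (h : Continuous φ) :
    Integrable φ (sphereMeasure (m + 2)) := by
  obtain ⟨C, hC⟩ := (isCompact_closedBall (0 : Amb (m + 2)) 1).exists_bound_of_continuousOn
    h.continuousOn
  refine Integrable.of_bound h.aestronglyMeasurable C ?_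
  filter_upwards [ae_sphere] with w hw
  exact hC w (by simp [hw.2])

/-- By invariance the integral of `φ` composed with the rotation by `θ` does not depend on `θ`;
differentiate under the integral sign at `θ = 0`. -/
lemma HasRotDeriv.integral_eq_zero {i j : Fin (m + 2 + 1)} {hij : i ≠ j}
    {φ ψ : Amb (m + 2) → ℂ} (h : HasRotDeriv hij φ ψ) :
    ∫ w, ψ w ∂(sphereMeasure (m + 2)) = 0 := by
  obtain ⟨C, hC⟩ := (isCompact_closedBall (0 : Amb (m + 2)) 1).exists_bound_of_continuousOn
    h.cont_deriv.continuousOn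
  have hc : ∀ θ, Continuous fun w => orthAct (planeRot hij θ) w :=
    fun θ => continuous_orthAct_right _
  have hd : ∀ w θ, HasDerivAt (fun θ : ℝ => φ (orthAct (planeRot hij θ) w))
      (ψ (orthAct (planeRot hij θ) w)) θ := by
    -- The group law transports the derivative at `0`, taken at the rotated point, to the parameter
    -- `θ`.
    intro w θ
    have h1 := h.hasDerivAt (orthAct (planeRot hij θ) w)
    rw [← sub_self θ] at h1
    have h2 := HasDerivAt.comp_sub_const θ θ h1
    refine h2.congr_of_eventuallyEq (Filter.Eventually.of_forall fun s => ?_)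
    simp [← orthAct_planeRot_add]
  have key := hasDerivAt_integral_of_dominated_loc_of_deriv_le (μ := sphereMeasure (m + 2))
    (F := fun θ w => φ (orthAct (planeRot hij θ) w))
    (F' := fun θ w => ψ (orthAct (planeRot hij θ) w)) (x₀ := (0 : ℝ)) (s := Set.univ)
    (bound := fun _ => C) Filter.univ_mem
    (Filter.Eventually.of_forall fun θ => (h.cont.comp (hc θ)).aestronglyMeasurable)
    (integrable_sphere (h.cont.comp (hc 0)))
    (h.cont_deriv.comp (hc 0)).aestronglyMeasurable
    (by
      filter_upwards [ae_sphere] with w hw θ _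
      exact hC _ (by simp [norm_orthAct, hw.2]))
    (integrable_const _) (Filter.Eventually.of_forall fun w θ _ => hd w θ)
  have hconst : (fun θ : ℝ => ∫ w, φ (orthAct (planeRot hij θ) w) ∂(sphereMeasure (m + 2))) =
      fun _ => ∫ w, φ w ∂(sphereMeasure (m + 2)) := by
    funext θ
    have hmp := measurePreserving_orthAct_sphere (planeRot hij θ)
    rw [← integral_map (φ := orthAct (planeRot hij θ)) hmp.measurable.aemeasurable
      h.cont.aestronglyMeasurable, hmp.map_eq]
  have h2 := key.2
  rw [hconst] at h2
  simpa only [orthAct_planeRot_zero] using h2.unique (hasDerivAt_const _ _)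

/-! ### The nilpotent derivation and integration by parts. -/

lemma one_ne_succ_succ (j : Fin (m + 1)) : (1 : Fin (m + 2 + 1)) ≠ j.succ.succ := by
  rw [← Fin.succ_zero_eq_one, Ne, Fin.succ_inj]
  exact (Fin.succ_ne_zero _).symm

/-- `ψ` is the derivative of `φ` along the complexified infinitesimal rotation that annihilates
`coordB` and maps `coordA` to the coordinate `j + 2`. -/
def HasNilDeriv (j : Fin (m + 1)) (φ ψ : Amb (m + 2) → ℂ) : Prop :=
  ∃ ψ₀ ψ₁ : Amb (m + 2) → ℂ, HasRotDeriv (Fin.succ_ne_zero j.succ).symm φ ψ₀ ∧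
    HasRotDeriv (one_ne_succ_succ j) φ ψ₁ ∧
    ∀ w, ψ w = (Real.sqrt 2 : ℂ)⁻¹ * (ψ₀ w + Complex.I * ψ₁ w)

namespace HasNilDeriv

variable {j : Fin (m + 1)} {φ ψ φ' ψ' : Amb (m + 2) → ℂ}

lemma congr_deriv (h : HasNilDeriv j φ ψ) (h' : ∀ w, ψ w = ψ' w) : HasNilDeriv j φ ψ' := by
  obtain ⟨ψ₀, ψ₁, h₀, h₁, e⟩ := h
  exact ⟨ψ₀, ψ₁, h₀, h₁, fun w => by rw [← h', e]⟩

lemma mul (h : HasNilDeriv j φ ψ) (h' : HasNilDeriv j φ' ψ') :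
    HasNilDeriv j (fun w => φ w * φ' w) (fun w => ψ w * φ' w + φ w * ψ' w) := by
  obtain ⟨ψ₀, ψ₁, h₀, h₁, e⟩ := h
  obtain ⟨ψ₀', ψ₁', h₀', h₁', e'⟩ := h'
  exact ⟨_, _, h₀.mul h₀', h₁.mul h₁', fun w => by simp only [e, e']; ring⟩

lemma pow (h : HasNilDeriv j φ ψ) (k : ℕ) :
    HasNilDeriv j (fun w => φ w ^ k) (fun w => k * φ w ^ (k - 1) * ψ w) := by
  obtain ⟨ψ₀, ψ₁, h₀, h₁, e⟩ := h
  exact ⟨_, _, h₀.pow k, h₁.pow k, fun w => by simp only [e]; ring⟩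

lemma integral_eq_zero (h : HasNilDeriv j φ ψ) : ∫ w, ψ w ∂(sphereMeasure (m + 2)) = 0 := by
  obtain ⟨ψ₀, ψ₁, h₀, h₁, e⟩ := h
  simp only [e]
  rw [integral_const_mul, integral_add (integrable_sphere h₀.cont_deriv)
    ((integrable_sphere h₁.cont_deriv).const_mul _), integral_const_mul, h₀.integral_eq_zero,
    h₁.integral_eq_zero]
  simp

lemma zero_coord : HasRotDeriv (one_ne_succ_succ j) (fun w => w 0) (fun _ => 0) :=
  .of_ne zero_ne_one_fin (Fin.succ_ne_zero _).symm

lemma one_coord : HasRotDeriv (Fin.succ_ne_zero j.succ).symm (fun w => w 1) (fun _ => 0) :=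
  .of_ne zero_ne_one_fin.symm (one_ne_succ_succ j)

lemma coordA_rot₀ : HasRotDeriv (Fin.succ_ne_zero j.succ).symm (coordA (m := m))
    (fun w => (Real.sqrt 2 : ℂ)⁻¹ * w j.succ.succ) := by
  have h := ((HasRotDeriv.fst (hij := (Fin.succ_ne_zero j.succ).symm)).add
    ((one_coord (j := j)).const_mul (-Complex.I))).const_mul (Real.sqrt 2 : ℂ)⁻¹
  convert h using 2 with w w
  · rw [coordA_eq]; ring
  · ring

lemma coordA_rot₁ : HasRotDeriv (one_ne_succ_succ j) (coordA (m := m))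
    (fun w => (Real.sqrt 2 : ℂ)⁻¹ * (-Complex.I * w j.succ.succ)) := by
  have h := ((zero_coord (j := j)).add
    ((HasRotDeriv.fst (hij := one_ne_succ_succ j)).const_mul (-Complex.I))).const_mul
      (Real.sqrt 2 : ℂ)⁻¹
  convert h using 2 with w w
  · rw [coordA_eq]; ring
  · ring

lemma coordB_rot₀ : HasRotDeriv (Fin.succ_ne_zero j.succ).symm (coordB (m := m))
    (fun w => (Real.sqrt 2 : ℂ)⁻¹ * w j.succ.succ) := by
  have h := ((HasRotDeriv.fst (hij := (Fin.succ_ne_zero j.succ).symm)).add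
    ((one_coord (j := j)).const_mul (Complex.I))).const_mul (Real.sqrt 2 : ℂ)⁻¹
  convert h using 2 with w w
  · rw [coordB_eq]; ring
  · ring

lemma coordB_rot₁ : HasRotDeriv (one_ne_succ_succ j) (coordB (m := m))
    (fun w => (Real.sqrt 2 : ℂ)⁻¹ * (Complex.I * w j.succ.succ)) := by
  have h := ((zero_coord (j := j)).add
    ((HasRotDeriv.fst (hij := one_ne_succ_succ j)).const_mul (Complex.I))).const_mul
      (Real.sqrt 2 : ℂ)⁻¹
  convert h using 2 with w w
  · rw [coordB_eq]; ring
  · ring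

lemma inv_sqrt_two_mul_self : (Real.sqrt 2 : ℂ)⁻¹ * (Real.sqrt 2 : ℂ)⁻¹ = 1 / 2 := by
  rw [← mul_inv, sqrt_two_mul_self]; norm_num

lemma coordA : HasNilDeriv j (coordA (m := m)) (fun w => w j.succ.succ) := by
  refine ⟨_, _, coordA_rot₀, coordA_rot₁, fun w => ?_⟩
  linear_combination (-2 * w j.succ.succ) * inv_sqrt_two_mul_self +
    (Real.sqrt 2 : ℂ)⁻¹ * (Real.sqrt 2 : ℂ)⁻¹ * w j.succ.succ * Complex.I_sq

/-- The real rotations commute with conjugation, but their complex combination does not: it acts by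
`a ↦ w_j ↦ -b ↦ 0` and `b̄ ↦ w̄_j ↦ -ā ↦ 0`. Powers of `ā` thus behave as constants in the
integrations by parts. -/
lemma conj_coordA : HasNilDeriv j (fun w => (starRingEnd ℂ) (Kepler.coordA w)) (fun _ => 0) := by
  refine ⟨_, _, coordA_rot₀.conj, coordA_rot₁.conj, fun w => ?_⟩
  simp only [map_mul, map_neg, map_inv₀, Complex.conj_ofReal, Complex.conj_I]
  linear_combination (-(Real.sqrt 2 : ℂ)⁻¹ * (Real.sqrt 2 : ℂ)⁻¹ *
    (starRingEnd ℂ) (w j.succ.succ)) * Complex.I_sq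

lemma conj_coordB : HasNilDeriv j (fun w => (starRingEnd ℂ) (coordB w))
    (fun w => (starRingEnd ℂ) (w j.succ.succ)) := by
  refine ⟨_, _, coordB_rot₀.conj, coordB_rot₁.conj, fun w => ?_⟩
  simp only [map_mul, map_inv₀, Complex.conj_ofReal, Complex.conj_I]
  linear_combination (-2 * (starRingEnd ℂ) (w j.succ.succ)) * inv_sqrt_two_mul_self +
    (Real.sqrt 2 : ℂ)⁻¹ * (Real.sqrt 2 : ℂ)⁻¹ * (starRingEnd ℂ) (w j.succ.succ) * Complex.I_sq

lemma coord : HasNilDeriv j (fun w => w j.succ.succ) (fun w => -coordB w) := by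
  refine ⟨_, _, HasRotDeriv.snd, HasRotDeriv.snd, fun w => ?_⟩
  simp only [coordB_eq]
  ring

lemma conj_coord : HasNilDeriv j (fun w => (starRingEnd ℂ) (w j.succ.succ))
    (fun w => -(starRingEnd ℂ) (Kepler.coordA w)) := by
  refine ⟨_, _, HasRotDeriv.snd.conj, HasRotDeriv.snd.conj, fun w => ?_⟩
  simp only [coordA_eq, map_neg, map_div₀, map_sub, map_mul, Complex.conj_ofReal, Complex.conj_I]
  ring

end HasNilDeriv

/-! ### Moments of `coordA` on the sphere -/

/-- The moment `∫ |coordA|^{2l} dμ`. -/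
def sphereMoment (m l : ℕ) : ℂ :=
  ∫ w : Amb (m + 2), coordA w ^ l * (starRingEnd ℂ) (coordA w) ^ l ∂(sphereMeasure (m + 2))

lemma sphereMoment_zero : sphereMoment m 0 = 1 := by
  simp [sphereMoment]

/-- With `T j = ∫ |a|^{2l} |w_j|²` and `J = ∫ |a|^{2l} |b|²`, two integrations by parts and the
equation `|w|² = 1` give linear relations between both moments, `J` and the `T j`; eliminating `J`
and the `T j` leaves the recursion. -/
lemma sphereMoment_succ (l : ℕ) : sphereMoment m (l + 1) * ((l + m + 1) * (2 * l + m + 3)) =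
    sphereMoment m l * ((l + 1) * (2 * l + m + 1)) := by
  have cA : Continuous (coordA (m := m)) := continuous_coordA
  have cB : Continuous (coordB (m := m)) := continuous_coordB
  have cj : ∀ j : Fin (m + 1), Continuous fun w : Amb (m + 2) => w j.succ.succ :=
    fun j => continuous_apply_amb _
  have cc := Complex.continuous_conj
  set S := sphereMeasure (m + 2) with hS
  set p : Amb (m + 2) → ℂ := fun w => coordA w ^ l * (starRingEnd ℂ) (coordA w) ^ l with hp
  have cp : Continuous p := by fun_prop
  set T : Fin (m + 1) → ℂ := fun j =>
    ∫ w, p w * (w j.succ.succ * (starRingEnd ℂ) (w j.succ.succ)) ∂S with hT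
  set J : ℂ := ∫ w, p w * (coordB w * (starRingEnd ℂ) (coordB w)) ∂S with hJ
  have iT : ∀ j : Fin (m + 1), Integrable
      (fun w => p w * (w j.succ.succ * (starRingEnd ℂ) (w j.succ.succ))) S := fun j =>
    integrable_sphere (by have := cj j; fun_prop)
  have iJ : Integrable (fun w => p w * (coordB w * (starRingEnd ℂ) (coordB w))) S :=
    integrable_sphere (by fun_prop)
  have iA : Integrable (fun w => coordA w ^ (l + 1) * (starRingEnd ℂ) (coordA w) ^ (l + 1)) S :=
    integrable_sphere (by fun_prop)
  -- Integrate the derivative of `a^{l+1} ā^l w̄_j`.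
  have h1 : ∀ j, sphereMoment m (l + 1) = (l + 1) * T j := by
    intro j
    have h := ((((HasNilDeriv.coordA (j := j)).pow (l + 1)).mul
      (HasNilDeriv.conj_coordA.pow l)).mul HasNilDeriv.conj_coord).congr_deriv
      (ψ' := fun w => (l + 1) * (p w * (w j.succ.succ * (starRingEnd ℂ) (w j.succ.succ))) -
        coordA w ^ (l + 1) * (starRingEnd ℂ) (coordA w) ^ (l + 1))
      (fun w => by simp only [hp, Nat.add_sub_cancel]; push_cast; ring)
    have h0 := h.integral_eq_zero
    rw [integral_sub ((iT j).const_mul _) iA, integral_const_mul] at h0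
    exact (sub_eq_zero.1 h0).symm
  -- Integrate the derivative of `a^l w_j ā^l b̄`, sum over `j`, and use `∑ w_j² = -2ab` on the
  -- cone.
  have h2 : -(2 * l * J) - (m + 1) * J + ∑ j, T j = 0 := by
    have e : ∀ j : Fin (m + 1), ∫ w, (l * coordA w ^ (l - 1) * (starRingEnd ℂ) (coordA w) ^ l *
        (starRingEnd ℂ) (coordB w)) * w j.succ.succ ^ 2 ∂S - J + T j = 0 := by
      intro j
      have i0 : Integrable (fun w => (l * coordA w ^ (l - 1) * (starRingEnd ℂ) (coordA w) ^ l *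
          (starRingEnd ℂ) (coordB w)) * w j.succ.succ ^ 2) S :=
        integrable_sphere (by have := cj j; fun_prop)
      have h := ((((HasNilDeriv.coordA (j := j)).pow l).mul HasNilDeriv.coord).mul
        ((HasNilDeriv.conj_coordA.pow l).mul HasNilDeriv.conj_coordB)).congr_deriv
        (ψ' := fun w => (l * coordA w ^ (l - 1) * (starRingEnd ℂ) (coordA w) ^ l *
          (starRingEnd ℂ) (coordB w)) * w j.succ.succ ^ 2 -
          p w * (coordB w * (starRingEnd ℂ) (coordB w)) +
          p w * (w j.succ.succ * (starRingEnd ℂ) (w j.succ.succ)))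
        (fun w => by simp only [hp]; ring)
      have h0 := h.integral_eq_zero
      rwa [integral_add (f := fun w => _ - _) (i0.sub iJ) (iT j), integral_sub i0 iJ] at h0
    have hsum := Finset.sum_eq_zero (s := Finset.univ) fun j _ => e j
    rw [Finset.sum_add_distrib, Finset.sum_sub_distrib, ← integral_finsetSum] at hsum
    · have hq : ∫ w, ∑ j : Fin (m + 1), (l * coordA w ^ (l - 1) *
          (starRingEnd ℂ) (coordA w) ^ l * (starRingEnd ℂ) (coordB w)) * w j.succ.succ ^ 2 ∂S =
          -(2 * l * J) := by
        rw [hJ, ← integral_const_mul, ← integral_neg]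
        refine integral_congr_ae ?_
        filter_upwards [ae_sphere] with w hw
        have hw1 := hw.1
        rw [cdot_self_eq] at hw1
        rw [← Finset.mul_sum, eq_neg_of_add_eq_zero_right hw1]
        simp only [hp]
        -- The exponent `l - 1` is truncated at `l = 0`, where the factor `l` removes the term.
        rcases l with _ | l
        · simp
        · simp only [Nat.add_sub_cancel]; ring
      rw [hq] at hsum
      simpa using hsum
    · intro j _
      exact integrable_sphere (by have := cj j; fun_prop)
  have h3 : sphereMoment m l = sphereMoment m (l + 1) + J + ∑ j, T j := by
    rw [hJ, hT, ← integral_finsetSum _ fun j _ => iT j, sphereMoment, sphereMoment,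
      ← integral_add iA iJ, ← integral_add (f := fun w => _ + _) (iA.add iJ) (integrable_finsetSum _ fun j _ => iT j)]
    refine integral_congr_ae ?_
    filter_upwards [ae_sphere] with w hw
    have hw2 := norm_sq_eq w
    rw [hw.2, one_pow] at hw2
    have hw3 : (1 : ℂ) = coordA w * (starRingEnd ℂ) (coordA w) +
        coordB w * (starRingEnd ℂ) (coordB w) +
        ∑ j : Fin (m + 1), w j.succ.succ * (starRingEnd ℂ) (w j.succ.succ) := by
      simp only [Complex.mul_conj, Complex.normSq_eq_norm_sq]
      exact_mod_cast hw2
    rw [← Finset.mul_sum]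
    simp only [hp]
    linear_combination (coordA w ^ l * (starRingEnd ℂ) (coordA w) ^ l) * hw3
  have h4 : ((m : ℂ) + 1) * sphereMoment m (l + 1) = (l + 1) * ∑ j, T j := by
    rw [Finset.mul_sum, ← Finset.sum_congr rfl fun j _ => h1 j]
    simp
  rw [h3]
  linear_combination (2 * (l : ℂ) + m + 2) * h4 + (l + 1) * h2

/-! ### The numbers `N(l)` and the value of the moments. -/

lemma dimN_factorial (l : ℕ) : (dimN (m + 2) l : ℚ) =
    (2 * l + m + 1) * ((l + m).factorial : ℚ) / ((l.factorial : ℚ) * ((m + 1).factorial : ℚ)) := by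
  have hl : (l.factorial : ℚ) ≠ 0 := by positivity
  have hm : ((m + 1).factorial : ℚ) ≠ 0 := by positivity
  have h1 : ((l + m + 1).choose (m + 1) : ℚ) =
      ((l + m + 1).factorial : ℚ) / (l.factorial * (m + 1).factorial) := by
    rw [eq_div_iff (mul_ne_zero hl hm), add_assoc l m 1]
    have := Nat.add_choose_mul_factorial_mul_factorial l (m + 1)
    rw [← Nat.choose_symm_add] at *
    push_cast [← this]
    ring
  rw [dimN, show l + (m + 2) - 1 = l + m + 1 by omega, show l + (m + 2) - 2 = l + m by omega,
    show m + 2 - 1 = m + 1 by omega, Nat.cast_add, h1]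
  -- At `l = 0` the second binomial coefficient is `0`; otherwise it is the first one with `l`
  -- lowered by one.
  rcases l with _ | l
  · simp [Nat.factorial_succ]
  · have hl' : (l.factorial : ℚ) ≠ 0 := by positivity
    have h2 : ((l + 1 + m).choose (m + 1) : ℚ) =
        ((l + 1 + m).factorial : ℚ) / (l.factorial * (m + 1).factorial) := by
      rw [eq_div_iff (mul_ne_zero hl' hm), show l + 1 + m = l + (m + 1) by ring]
      have := Nat.add_choose_mul_factorial_mul_factorial l (m + 1)
      rw [← Nat.choose_symm_add] at *
      push_cast [← this]
      ring
    rw [h2, Nat.factorial_succ (l + 1 + m), Nat.factorial_succ l]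
    push_cast
    field_simp
    ring

lemma dimN_pos (l : ℕ) : 0 < dimN (m + 2) l :=
  Nat.add_pos_left (Nat.choose_pos (by omega)) _

lemma dimN_succ (l : ℕ) : (dimN (m + 2) (l + 1) : ℂ) * ((l + 1) * (2 * l + m + 1)) =
    dimN (m + 2) l * ((l + m + 1) * (2 * l + m + 3)) := by
  have h : (dimN (m + 2) (l + 1) : ℚ) * ((l + 1) * (2 * l + m + 1)) =
    dimN (m + 2) l * ((l + m + 1) * (2 * l + m + 3)) := by
    rw [dimN_factorial, dimN_factorial, show l + 1 + m = (l + m) + 1 by ring,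
      Nat.factorial_succ (l + m), Nat.factorial_succ l]
    push_cast
    have hl : (l.factorial : ℚ) ≠ 0 := by positivity
    have hm : ((m + 1).factorial : ℚ) ≠ 0 := by positivity
    field_simp
    ring
  exact_mod_cast h

lemma sphereMoment_eq (l : ℕ) : sphereMoment m l = (dimN (m + 2) l : ℂ)⁻¹ := by
  refine eq_inv_of_mul_eq_one_left ?_
  induction l with
  | zero => simp [sphereMoment_zero, dimN]
  | succ l ih =>
    have h1 := sphereMoment_succ (m := m) l
    have h2 := dimN_succ (m := m) l
    have h0 : ((l : ℂ) + m + 1) * (2 * l + m + 3) ≠ 0 := by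
      exact_mod_cast (show (l + m + 1) * (2 * l + m + 3) ≠ 0 by positivity)
    have h0' : ((l : ℂ) + 1) * (2 * l + m + 1) ≠ 0 := by
      exact_mod_cast (show (l + 1) * (2 * l + m + 1) ≠ 0 by positivity)
    refine mul_right_cancel₀ (mul_ne_zero h0 h0') ?_
    linear_combination (dimN (m + 2) (l + 1) * ((l + 1) * (2 * (l : ℂ) + m + 1))) * h1 +
      (sphereMoment m l * ((l + 1) * (2 * (l : ℂ) + m + 1))) * h2 +
      (((l : ℂ) + 1) * (2 * l + m + 1) * (((l : ℂ) + m + 1) * (2 * l + m + 3))) * ih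

end

section

variable {n m : ℕ}

/-! ### Hyperplane sections of the sphere are null -/

/-- A polynomial curve in the Kepler manifold which is not contained in a hyperplane. -/
def momentCurve (m : ℕ) (x : ℝ) : Amb (m + 2) :=
  WithLp.toLp 2 (Fin.cons (1 - ∑ j : Fin (m + 1), (x : ℂ) ^ (2 * (j.val + 1)))
    (Fin.cons (Complex.I * (1 + ∑ j : Fin (m + 1), (x : ℂ) ^ (2 * (j.val + 1))))
      fun j => 2 * (x : ℂ) ^ (j.val + 1)))

@[simp] lemma momentCurve_zero (x : ℝ) :
    momentCurve m x 0 = 1 - ∑ j : Fin (m + 1), (x : ℂ) ^ (2 * (j.val + 1)) := rfl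

@[simp] lemma momentCurve_one (x : ℝ) : momentCurve m x 1 =
    Complex.I * (1 + ∑ j : Fin (m + 1), (x : ℂ) ^ (2 * (j.val + 1))) := rfl

@[simp] lemma momentCurve_succ_succ (x : ℝ) (j : Fin (m + 1)) :
    momentCurve m x j.succ.succ = 2 * (x : ℂ) ^ (j.val + 1) := rfl

lemma momentCurve_mem (x : ℝ) : momentCurve m x ∈ keplerManifold (m + 2) := by
  constructor
  · rw [cdot, Fin.sum_univ_succ, Fin.sum_univ_succ]
    simp only [Fin.succ_zero_eq_one, momentCurve_zero, momentCurve_one, momentCurve_succ_succ]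
    have h : ∑ j : Fin (m + 1), (2 * (x : ℂ) ^ (j.val + 1)) * (2 * (x : ℂ) ^ (j.val + 1)) =
        4 * ∑ j : Fin (m + 1), (x : ℂ) ^ (2 * (j.val + 1)) := by
      rw [Finset.mul_sum]
      exact Finset.sum_congr rfl fun j _ => by ring
    rw [h]
    linear_combination (1 + ∑ j : Fin (m + 1), (x : ℂ) ^ (2 * (j.val + 1))) ^ 2 * Complex.I_sq
  · intro h
    have h0 : momentCurve m x 0 = 0 := by rw [h]; rfl
    have h1 : momentCurve m x 1 = 0 := by rw [h]; rfl
    rw [momentCurve_zero] at h0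
    rw [momentCurve_one, mul_eq_zero] at h1
    have h2 := h1.resolve_left Complex.I_ne_zero
    have : (2 : ℂ) = 0 := by linear_combination h0 + h2
    norm_num at this

open Polynomial in
/-- The pairing with `momentCurve` as a polynomial in the parameter. -/
def momentPoly (w : Amb (m + 2)) : ℂ[X] :=
  C ((Real.sqrt 2 : ℂ) * coordA w) -
    C ((Real.sqrt 2 : ℂ) * coordB w) * ∑ j : Fin (m + 1), X ^ (2 * (j.val + 1)) +
    ∑ j : Fin (m + 1), C (2 * w j.succ.succ) * X ^ (j.val + 1)

lemma momentPoly_eval (w : Amb (m + 2)) (x : ℝ) :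
    (momentPoly w).eval (x : ℂ) = cdot w (cconj (momentCurve m x)) := by
  rw [cdot, Fin.sum_univ_succ, Fin.sum_univ_succ]
  simp only [Fin.succ_zero_eq_one, cconj_apply, momentCurve_zero, momentCurve_one,
    momentCurve_succ_succ, momentPoly, Polynomial.eval_add, Polynomial.eval_sub,
    Polynomial.eval_mul, Polynomial.eval_finsetSum, Polynomial.eval_pow, Polynomial.eval_C,
    Polynomial.eval_X, map_sub, map_add, map_sum, map_mul, map_one, map_pow, Complex.conj_ofReal,
    Complex.conj_I, coordA_eq, coordB_eq, mul_div_cancel₀ _ sqrt_two_ne_zero, map_ofNat,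
    Polynomial.eval_ofNat]
  have h : ∑ j : Fin (m + 1), 2 * w j.succ.succ * (x : ℂ) ^ (j.val + 1) =
      ∑ j : Fin (m + 1), w j.succ.succ * (2 * (x : ℂ) ^ (j.val + 1)) :=
    Finset.sum_congr rfl fun j _ => by ring
  rw [h]
  ring

lemma natDegree_momentPoly_le (w : Amb (m + 2)) : (momentPoly w).natDegree ≤ 2 * (m + 1) := by
  refine Polynomial.natDegree_add_le_of_degree_le
    ((Polynomial.natDegree_sub_le _ _).trans (max_le ?_ ?_)) ?_
  · rw [Polynomial.natDegree_C]
    omega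
  · refine (Polynomial.natDegree_C_mul_le _ _).trans ?_
    refine Polynomial.natDegree_sum_le_of_forall_le _ _ fun j _ => ?_
    rw [Polynomial.natDegree_X_pow]
    omega
  · refine Polynomial.natDegree_sum_le_of_forall_le _ _ fun j _ => ?_
    refine (Polynomial.natDegree_C_mul_X_pow_le _ _).trans ?_
    omega

/-- The coefficients recover `w`: degree `0` gives `coordA`, the top degree `2(m + 1)`, out of reach
of the last sum, gives `coordB`, and then degrees `1, …, m + 1` give the remaining coordinates. -/
lemma momentPoly_ne_zero {w : Amb (m + 2)} (hw : w ≠ 0) : momentPoly w ≠ 0 := by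
  intro h
  have hc : ∀ k, (momentPoly w).coeff k = 0 := fun k => by rw [h, Polynomial.coeff_zero]
  simp only [momentPoly, Polynomial.coeff_add, Polynomial.coeff_sub, Polynomial.coeff_C,
    Polynomial.coeff_C_mul, Polynomial.finsetSum_coeff, Polynomial.coeff_X_pow] at hc
  have hA : coordA w = 0 := by
    have := hc 0
    simpa [sqrt_two_ne_zero] using this
  have hB : coordB w = 0 := by
    have h1 := hc (2 * (m + 1))
    have h2 : ∑ j : Fin (m + 1), (if 2 * (m + 1) = 2 * (j.val + 1) then (1 : ℂ) else 0) = 1 := by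
      rw [Finset.sum_eq_single (Fin.last m)]
      · simp
      · intro j _ hj
        rw [if_neg]
        intro h'
        exact hj (Fin.ext (by simp; omega))
      · simp
    have h3 : ∑ j : Fin (m + 1), 2 * w j.succ.succ *
        (if 2 * (m + 1) = j.val + 1 then (1 : ℂ) else 0) = 0 := by
      refine Finset.sum_eq_zero fun j _ => ?_
      rw [if_neg (by omega), mul_zero]
    rw [h2, h3, if_neg (by omega)] at h1
    simpa [sqrt_two_ne_zero] using h1
  refine hw (ext_coord (by rw [hA]; simp [coordA, cdot]) (by rw [hB]; simp [coordB, cdot])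
    fun j => ?_)
  have h1 := hc (j.val + 1)
  have h2 : ∑ k : Fin (m + 1), 2 * w k.succ.succ *
      (if j.val + 1 = k.val + 1 then (1 : ℂ) else 0) = 2 * w j.succ.succ := by
    rw [Finset.sum_eq_single j]
    · simp
    · intro k _ hk
      rw [if_neg, mul_zero]
      intro h'
      exact hk (Fin.ext (by omega))
    · simp
  rw [hB, h2] at h1
  simpa using h1

lemma measurableSet_cdot_eq_zero (v : Amb n) : MeasurableSet {w : Amb n | cdot w v = 0} :=
  (isClosed_eq (continuous_cdot_left v) continuous_const).measurableSet

lemma sphereMeasure_hyperplane {v : Amb (m + 2)} (hv : v ∈ keplerManifold (m + 2)) :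
    sphereMeasure (m + 2) {w | cdot w (cconj v) = 0} =
      sphereMeasure (m + 2) {w | coordA w = 0} := by
  obtain ⟨g, hg⟩ := exists_smul_orthAct_basePoint hv
  have h0 : (‖v‖ : ℂ) ≠ 0 := by simpa using hv.2
  rw [← (measurePreserving_orthAct_sphere g).measure_preimage
    (measurableSet_cdot_eq_zero _).nullMeasurableSet]
  congr 1
  ext w
  simp only [Set.mem_preimage, Set.mem_ofPred_eq]
  rw [hg, cdot_cconj_orthAct, cconj_smul, cdot_smul_right, coordA, Complex.conj_ofReal,
    mul_eq_zero, or_iff_right h0]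

/-- All sections `w · v̄ = 0` with `v` in the cone have the same mass (`sphereMeasure_hyperplane`).
Take `N` of them along the moment curve: a unit vector lies in at most `2(m + 1)`, since its
parameters are roots of `momentPoly`. So `N` times the common mass is at most `2(m + 1)` for every
`N`. -/
lemma ae_sphere_coordA_ne_zero : ∀ᵐ w ∂(sphereMeasure (m + 2)), coordA w ≠ 0 := by
  rw [ae_iff]
  simp only [not_not]
  by_contra hc
  obtain ⟨N, hN⟩ := ENNReal.exists_nat_mul_gt hc (b := ((2 * (m + 1) : ℕ) : ℝ≥0∞))
    (ENNReal.natCast_ne_top _)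
  refine absurd hN (not_lt.2 ?_)
  set E : ℕ → Set (Amb (m + 2)) := fun k => {w | cdot w (cconj (momentCurve m k)) = 0} with hE
  have hEm : ∀ k, MeasurableSet (E k) := fun k => measurableSet_cdot_eq_zero _
  have h1 : (N : ℝ≥0∞) * sphereMeasure (m + 2) {w | coordA w = 0} =
      ∫⁻ w, ∑ k ∈ Finset.range N, (E k).indicator 1 w ∂(sphereMeasure (m + 2)) := by
    rw [lintegral_finsetSum _ fun k _ => measurable_one.indicator (hEm k)]
    simp only [lintegral_indicator_one (hEm _)]
    have h0 : ∀ k, sphereMeasure (m + 2) (E k) = sphereMeasure (m + 2) {w | coordA w = 0} :=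
      fun k => sphereMeasure_hyperplane (momentCurve_mem (k : ℝ))
    simp [h0]
  rw [h1]
  have h2 : ∀ᵐ w ∂(sphereMeasure (m + 2)),
      ∑ k ∈ Finset.range N, (E k).indicator (1 : Amb (m + 2) → ℝ≥0∞) w ≤
        ((2 * (m + 1) : ℕ) : ℝ≥0∞) := by
    filter_upwards [ae_sphere] with w hw
    have hw0 : w ≠ 0 := by
      rw [← norm_ne_zero_iff, hw.2]; exact one_ne_zero
    classical
    simp only [Set.indicator_apply, Pi.one_apply]
    rw [Finset.sum_boole]
    refine Nat.cast_le.2 (le_trans ?_ (natDegree_momentPoly_le w))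
    refine le_trans ?_ (Polynomial.card_roots' (momentPoly w))
    refine le_trans ?_ (Multiset.toFinset_card_le _)
    refine Finset.card_le_card_of_injOn (fun k : ℕ => (k : ℂ)) (fun k hk => ?_)
      fun a _ b _ hab => Nat.cast_injective hab
    have hk2 := (Finset.mem_filter.1 hk).2
    simp only [Finset.mem_coe, Multiset.mem_toFinset]
    rw [Polynomial.mem_roots (momentPoly_ne_zero hw0), Polynomial.IsRoot.def]
    have := momentPoly_eval w (k : ℝ)
    rw [hk2] at this
    simpa using this
  refine (lintegral_mono_ae h2).trans ?_
  simp

/-! ### The measure `ρ × μ` in terms of `coordA` -/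

variable (ρ : Measure ℝ)

lemma ae_rot_coordA_ne_zero (hρ : ρ (Set.Iic 0) = 0) :
    ∀ᵐ w ∂(rotMeasure (m + 2) ρ), coordA w ≠ 0 := by
  refine ae_rot ρ ?_ ?_
  · exact (isOpen_ne_fun continuous_coordA continuous_const).measurableSet
  · have h1 : ∀ᵐ t ∂ρ, 0 < t := by
      rw [ae_iff]
      simpa [Set.Iic_def] using hρ
    filter_upwards [h1] with t ht
    filter_upwards [ae_sphere_coordA_ne_zero] with w hw
    rw [coordA_smul]
    exact mul_ne_zero (by exact_mod_cast ht.ne') hw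

lemma lintegral_coordA_sphere (l : ℕ) :
    ∫⁻ w, ENNReal.ofReal (‖coordA w‖ ^ (2 * l)) ∂(sphereMeasure (m + 2)) =
      (dimN (m + 2) l : ℝ≥0∞)⁻¹ := by
  have hc : Continuous fun w : Amb (m + 2) => ‖coordA w‖ ^ (2 * l) := by
    have := continuous_coordA (m := m); fun_prop
  have h1 : ((∫ w, ‖coordA w‖ ^ (2 * l) ∂(sphereMeasure (m + 2)) : ℝ) : ℂ) =
      sphereMoment m l := by
    rw [sphereMoment, ← integral_complex_ofReal]
    refine integral_congr_ae (Filter.Eventually.of_forall fun w => ?_)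
    simp only
    rw [← mul_pow, Complex.mul_conj, Complex.normSq_eq_norm_sq, pow_mul]
    push_cast
    rfl
  rw [sphereMoment_eq] at h1
  have h2 : ∫ w, ‖coordA w‖ ^ (2 * l) ∂(sphereMeasure (m + 2)) = (dimN (m + 2) l : ℝ)⁻¹ := by
    apply Complex.ofReal_injective
    rw [h1]
    simp
  have hi : Integrable (fun w => ‖coordA w‖ ^ (2 * l)) (sphereMeasure (m + 2)) := by
    exact (integrable_sphere (m := m) (Complex.continuous_ofReal.comp hc)).re
  rw [← ofReal_integral_eq_lintegral_ofReal hi (Filter.Eventually.of_forall fun w => by positivity),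
    h2, ENNReal.ofReal_inv_of_pos (by exact_mod_cast dimN_pos l), ENNReal.ofReal_natCast]

/-- Homogeneity of `coordA` splits the integral into the radial moment `q_{2l}` and the spherical
moment `1 / N(l)`. -/
lemma lintegral_coordA_rot (hρ : ρ (Set.Iic 0) = 0) (l : ℕ) :
    ∫⁻ w, ENNReal.ofReal (‖coordA w‖ ^ (2 * l)) ∂(rotMeasure (m + 2) ρ) =
      dCoeff (m + 2) ρ l := by
  have hc : Measurable fun w : Amb (m + 2) => ENNReal.ofReal (‖coordA w‖ ^ (2 * l)) := by
    have := continuous_coordA (m := m)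
    exact ENNReal.measurable_ofReal.comp (by fun_prop : Continuous _).measurable
  rw [rotMeasure, lintegral_map hc measurable_scale, lintegral_prod
    (fun p : ℝ × Amb (m + 2) => ENNReal.ofReal (‖coordA ((p.1 : ℂ) • p.2)‖ ^ (2 * l)))
    (hc.comp measurable_scale).aemeasurable, dCoeff, moment, ENNReal.div_eq_inv_mul, mul_comm (dimN (m + 2) l : ℝ≥0∞)⁻¹]
  have h1 : ∀ᵐ t ∂ρ, 0 < t := by
    rw [ae_iff]
    simpa [Set.Iic_def] using hρ
  have hr : ρ.restrict (Set.Ioi 0) = ρ := Measure.restrict_eq_self_of_ae_mem h1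
  rw [hr]
  rw [← lintegral_coordA_sphere, ← lintegral_mul_const _ (by fun_prop)]
  refine lintegral_congr_ae ?_
  filter_upwards [h1] with t ht
  rw [← lintegral_const_mul _ hc]
  refine lintegral_congr fun w => ?_
  rw [coordA_smul, norm_mul, mul_pow, Complex.norm_real, Real.norm_of_nonneg ht.le,
    ENNReal.ofReal_mul (by positivity)]

end

section

variable {n m : ℕ}

/-! ### Holomorphic functions on subsets of the Kepler manifold -/

/-- `F` coincides on `B`, near each point of `B`, with a holomorphic function. -/
def IsHolOn (F : Amb n → ℂ) (B : Set (Amb n)) : Prop :=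
  ∀ z ∈ B, ∃ U : Set (Amb n), IsOpen U ∧ z ∈ U ∧
    ∃ F' : Amb n → ℂ, DifferentiableOn ℂ F' U ∧ ∀ w ∈ B, w ∈ U → F w = F' w

lemma IsHolOn.continuousOn {F : Amb n → ℂ} {B : Set (Amb n)} (h : IsHolOn F B) :
    ContinuousOn F B := by
  intro z hz
  obtain ⟨U, hU, hzU, F', hF', hFF'⟩ := h z hz
  have h1 : ContinuousWithinAt F' B z :=
    (hF'.continuousOn.continuousAt (hU.mem_nhds hzU)).continuousWithinAt
  refine h1.congr_of_eventuallyEq ?_ (hFF' z hz hzU)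
  filter_upwards [self_mem_nhdsWithin, mem_nhdsWithin_of_mem_nhds (hU.mem_nhds hzU)] with w hw hwU
  exact hFF' w hw hwU

lemma IsHolOn.differentiableAt_comp {F : Amb n → ℂ} {B : Set (Amb n)} (h : IsHolOn F B)
    {γ : ℂ → Amb n} {t : ℂ} (hγ : DifferentiableAt ℂ γ t) (hB : ∀ᶠ s in nhds t, γ s ∈ B) :
    DifferentiableAt ℂ (fun s => F (γ s)) t := by
  obtain ⟨U, hU, hzU, F', hF', hFF'⟩ := h (γ t) hB.self_of_nhds
  have h1 : DifferentiableAt ℂ (fun s => F' (γ s)) t :=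
    (hF'.differentiableAt (hU.mem_nhds hzU)).comp t hγ
  refine h1.congr_of_eventuallyEq ?_
  filter_upwards [hB, hγ.continuousAt (hU.mem_nhds hzU)] with s hs hsU
  exact hFF' _ hs hsU

lemma IsHolOn.comp_orthAct {F : Amb n → ℂ} {R : ℝ≥0∞} (h : IsHolOn F (keplerBall n R))
    (g : OrthGroup n) : IsHolOn (fun w => F (orthAct g w)) (keplerBall n R) := by
  intro z hz
  obtain ⟨U, hU, hzU, F', hF', hFF'⟩ := h _ (orthAct_mem_keplerBall g hz)
  refine ⟨orthAct g ⁻¹' U, hU.preimage (continuous_orthAct_right g), hzU,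
    fun w => F' (orthAct g w), ?_, fun w hw hwU => hFF' _ (orthAct_mem_keplerBall g hw) hwU⟩
  exact hF'.comp (differentiable_orthAct g).differentiableOn fun w hw => hw

lemma smul_basePoint_mem {R : ℝ≥0∞} {u : ℂ} (hu : u ≠ 0) (huR : ENNReal.ofReal ‖u‖ < R) :
    u • basePoint (m + 2) ∈ keplerBall (m + 2) R := by
  refine ⟨⟨by rw [cdot_smul_left, cdot_smul_right, cdot_basePoint_self]; simp, ?_⟩, ?_⟩
  · rw [← norm_ne_zero_iff, norm_smul, norm_basePoint]
    simpa using hu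
  · rwa [norm_smul, norm_basePoint, mul_one]

/-- The mean value property along the flow. -/
lemma circleAverage_flow {F : Amb (m + 2) → ℂ} {R : ℝ≥0∞} (h : IsHolOn F (keplerBall (m + 2) R))
    {w : Amb (m + 2)} (hw : w ∈ keplerBall (m + 2) R) (ha : coordA w ≠ 0) :
    Real.circleAverage (fun c => F (flow c w)) 0 1 = F (coordA w • basePoint (m + 2)) := by
  rw [← flow_zero]
  refine DiffContOnCl.circleAverage (f := fun c => F (flow c w)) ⟨fun c hc => ?_, ?_⟩
  · refine (h.differentiableAt_comp (differentiable_flow w c) ?_).differentiableWithinAt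
    filter_upwards [Metric.isOpen_ball.mem_nhds hc] with s hs
    refine flow_mem_keplerBall hw ha ?_
    have : ‖s‖ < 1 := by simpa using hs
    exact this.le
  · refine h.continuousOn.comp (differentiable_flow w).continuous.continuousOn fun c hc => ?_
    refine flow_mem_keplerBall hw ha ?_
    have := Metric.closure_ball_subset_closedBall hc
    simpa using this

/-- Near `0`, a holomorphic function is bounded along the line through the base point. -/
lemma exists_bound_smul_basePoint {F : Amb (m + 2) → ℂ} {R : ℝ≥0∞}
    (h : IsHolOn F (keplerBall (m + 2) R)) {r : ℝ} (hr : 0 < r) (hrR : ENNReal.ofReal r < R) :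
    ∃ C : ℝ, ∀ u : ℂ, u ≠ 0 → ‖u‖ < r → ‖F (u • basePoint (m + 2))‖ ≤ C := by
  -- The section of the cone by the sphere of radius `r` is compact and avoids the vertex; the mean
  -- value property along the flow carries the bound there to all small `u e`.
  have hK : IsCompact ({w : Amb (m + 2) | cdot w w = 0} ∩ Metric.sphere 0 r) :=
    (isCompact_sphere _ _).inter_left (isClosed_eq continuous_cdot_self continuous_const)
  have hKB : {w : Amb (m + 2) | cdot w w = 0} ∩ Metric.sphere 0 r ⊆ keplerBall (m + 2) R := by
    rintro w ⟨hw1, hw2⟩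
    have hw3 : ‖w‖ = r := by simpa using hw2
    refine ⟨⟨hw1, ?_⟩, by rwa [hw3]⟩
    rw [← norm_ne_zero_iff, hw3]
    exact hr.ne'
  obtain ⟨C, hC⟩ := hK.exists_bound_of_continuousOn (h.continuousOn.mono hKB)
  refine ⟨C, fun u hu hur => ?_⟩
  have hu0 : (‖u‖ : ℂ) ≠ 0 := by simpa using hu
  have hs0 : 0 ≤ 2 * (r - ‖u‖) * ‖u‖ := by
    have : 0 ≤ r - ‖u‖ := by linarith
    positivity
  -- A point of the cone of norm `r` with `coordA = u`: take `|b| = r - |u|` with phase making `2ub`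
  -- negative, and one further coordinate `s` with `s² = -2ub`. Then `|u|² + |b|² + s² = (|u| +
  -- |b|)² = r²`.
  set s : ℝ := Real.sqrt (2 * (r - ‖u‖) * ‖u‖) with hs
  have hss : s ^ 2 = 2 * (r - ‖u‖) * ‖u‖ := Real.sq_sqrt hs0
  set b : ℂ := -((r - ‖u‖ : ℝ) : ℂ) * (‖u‖ / u) with hb
  have hbn : ‖b‖ = r - ‖u‖ := by
    rw [hb, norm_mul, norm_neg, norm_div, Complex.norm_real, Complex.norm_real, norm_norm,
      div_self (by simpa using hu), mul_one, Real.norm_of_nonneg (by linarith)]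
  set w : Amb (m + 2) := ofCoord u b (Fin.cons (s : ℂ) fun _ => 0) with hw
  have hwA : coordA w = u := coordA_ofCoord _ _ _
  have hwB : coordB w = b := coordB_ofCoord _ _ _
  have hwj : ∀ j : Fin (m + 1), w j.succ.succ = Fin.cons (α := fun _ => ℂ) (s : ℂ) (fun _ => 0) j :=
    fun j => rfl
  have hww : cdot w w = 0 := by
    rw [cdot_self_eq, hwA, hwB, Finset.sum_congr rfl fun j _ => by rw [hwj j], Fin.sum_univ_succ]
    simp only [Fin.cons_zero, Fin.cons_succ]
    have : (s : ℂ) ^ 2 = 2 * (r - ‖u‖) * ‖u‖ := by exact_mod_cast hss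
    rw [this, hb]
    push_cast
    field_simp
    simp
  have hwn : ‖w‖ = r := by
    refine (pow_left_inj₀ (norm_nonneg _) hr.le two_ne_zero).1 ?_
    rw [norm_sq_eq, hwA, hwB, Finset.sum_congr rfl fun j _ => by rw [hwj j], Fin.sum_univ_succ]
    simp only [Fin.cons_zero, Fin.cons_succ, Complex.norm_real, hbn, Real.norm_eq_abs, sq_abs, hss]
    simp
    ring
  have hwK : w ∈ {w : Amb (m + 2) | cdot w w = 0} ∩ Metric.sphere 0 r := ⟨hww, by simp [hwn]⟩
  have hm := circleAverage_flow h (hKB hwK) (by rwa [hwA])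
  rw [hwA] at hm
  rw [← hm, Real.circleAverage_eq_circleIntegral one_ne_zero]
  refine (circleIntegral.norm_two_pi_i_inv_smul_integral_le_of_norm_le_const (C := C) zero_le_one
    fun z hz => ?_).trans (by simp)
  have hz1 : ‖z‖ = 1 := by simpa using hz
  rw [sub_zero, norm_smul, norm_inv, hz1, inv_one, one_mul]
  refine hC _ ⟨?_, ?_⟩
  · simp only [Set.mem_ofPred_eq]
    rw [cdot_flow_self, hww, mul_zero]
  · simp [norm_flow hz1, hwn]

lemma circleAverage_mul_right (f : ℂ → ℂ) (u : ℂ) :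
    Real.circleAverage (fun c => f (c * u)) 0 1 = Real.circleAverage f 0 ‖u‖ := by
  rw [Real.circleAverage_eq_integral_add (c := 0) (R := ‖u‖) u.arg, Real.circleAverage_def]
  congr 2
  funext θ
  congr 1
  simp only [circleMap, zero_add, Complex.ofReal_one, one_mul, Complex.ofReal_add, add_mul,
    Complex.exp_add]
  linear_combination (-Complex.exp (θ * Complex.I)) * Complex.norm_mul_exp_arg_mul_I u

/-- The Taylor expansion of a holomorphic function along the line through the base point. -/
lemma exists_taylor_smul_basePoint {F : Amb (m + 2) → ℂ} {R : ℝ≥0∞}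
    (h : IsHolOn F (keplerBall (m + 2) R)) : ∃ a : ℕ → ℂ, ∀ u : ℂ, u ≠ 0 →
      ENNReal.ofReal ‖u‖ < R →
      HasSum (fun l => a l * u ^ l) (F (u • basePoint (m + 2))) ∧
      ∀ l, Real.circleAverage (fun c => F ((c * u) • basePoint (m + 2)) *
        (starRingEnd ℂ) (c * u) ^ l) 0 1 = a l * ((‖u‖ ^ (2 * l) : ℝ) : ℂ) := by
  set G₀ : ℂ → ℂ := fun u => F (u • basePoint (m + 2)) with hG₀
  -- The vertex is not in the domain, so the value at `0` is defined as a limit; boundedness near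
  -- `0` makes the singularity removable.
  set G : ℂ → ℂ := Function.update G₀ 0 ((nhdsWithin 0 {0}ᶜ).limUnder G₀) with hG
  have hGu : ∀ u, u ≠ 0 → G u = G₀ u := fun u hu => Function.update_of_ne hu _ _
  have hdiff : ∀ r : ℝ, 0 < r → ENNReal.ofReal r < R → DifferentiableOn ℂ G (Metric.ball 0 r) := by
    intro r hr hrR
    obtain ⟨C, hC⟩ := exists_bound_smul_basePoint h hr hrR
    refine Complex.differentiableOn_update_limUnder_of_bddAbove (Metric.ball_mem_nhds _ hr) ?_ ?_
    · rintro u ⟨hu, hu0⟩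
      have hγ : DifferentiableAt ℂ (fun u : ℂ => u • basePoint (m + 2)) u :=
        (differentiable_id.smul_const _) u
      refine (h.differentiableAt_comp hγ ?_).differentiableWithinAt
      filter_upwards [Metric.isOpen_ball.mem_nhds hu, isOpen_ne.mem_nhds hu0] with s hs hs0
      refine smul_basePoint_mem hs0 (lt_of_le_of_lt (ENNReal.ofReal_le_ofReal ?_) hrR)
      have : ‖s‖ < r := by simpa using hs
      exact this.le
    · refine ⟨C, ?_⟩
      rintro _ ⟨u, ⟨hu, hu0⟩, rfl⟩
      exact hC u hu0 (by simpa using hu)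
  refine ⟨fun l => (l.factorial : ℂ)⁻¹ * iteratedDeriv l G 0, fun u hu huR => ?_⟩
  obtain ⟨r', hr', hr'R⟩ := ENNReal.lt_iff_exists_nnreal_btwn.1 huR
  obtain ⟨r, hr⟩ : ∃ r : ℝ, r = (r' : ℝ) := ⟨_, rfl⟩
  have hur : ‖u‖ < r := by
    have := (ENNReal.ofReal_lt_coe_iff (norm_nonneg u)).1 hr'
    rw [hr]; exact_mod_cast this
  have hr0 : 0 < r := lt_of_le_of_lt (norm_nonneg _) hur
  have hd := hdiff r hr0 (by rwa [hr, ENNReal.ofReal_coe_nnreal])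
  have hu0 : 0 < ‖u‖ := norm_pos_iff.2 hu
  constructor
  · have hs := Complex.hasSum_taylorSeries_on_ball hd (z := u) (by simpa using hur)
    rw [hGu u hu] at hs
    have e : (fun l : ℕ => (l.factorial : ℂ)⁻¹ * iteratedDeriv l G 0 * u ^ l) =
        fun l : ℕ => (l.factorial : ℂ)⁻¹ • (u - 0) ^ l • iteratedDeriv l G 0 := by
      funext l
      simp only [sub_zero, smul_eq_mul]
      ring
    rw [e]
    exact hs
  · intro l
    have hD : DiffContOnCl ℂ G (Metric.ball 0 ‖u‖) :=
      ((hd.mono (Metric.closedBall_subset_ball hur)).diffContOnCl_ball subset_rfl)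
    have hI := hD.circleIntegral_one_div_sub_center_pow_smul hu0 l
    have h1 := circleAverage_mul_right (fun z => G₀ z * (starRingEnd ℂ) z ^ l) u
    have h2 : Real.circleAverage (fun z => G₀ z * (starRingEnd ℂ) z ^ l) 0 ‖u‖ =
        Real.circleAverage (fun z => ((‖u‖ ^ (2 * l) : ℝ) : ℂ) • ((1 / z ^ l) * G z)) 0 ‖u‖ := by
      refine Real.circleAverage_congr_sphere fun z hz => ?_
      have hz1 : ‖z‖ = ‖u‖ := by simpa using hz
      have hz0 : z ≠ 0 := by rw [← norm_ne_zero_iff, hz1]; exact hu0.ne'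
      -- On this circle `z̄ = |u|² / z`, which turns the average into Cauchy's integral for the
      -- `l`-th Taylor coefficient.
      have hzz : (starRingEnd ℂ) z = ((‖u‖ ^ 2 : ℝ) : ℂ) / z := by
        rw [eq_div_iff hz0, mul_comm, Complex.mul_conj, Complex.normSq_eq_norm_sq, hz1]
      rw [hGu z hz0, hzz, div_pow, pow_mul]
      push_cast
      simp only [smul_eq_mul]
      ring
    rw [h1, h2, Real.circleAverage_fun_smul, Real.circleAverage_eq_circleIntegral hu0.ne']
    have h3 : ∀ z : ℂ, (z - 0)⁻¹ • (1 / z ^ l * G z) = (1 / (z - 0) ^ (l + 1)) • G z := by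
      intro z
      simp only [sub_zero, smul_eq_mul, one_div, pow_succ, mul_inv]
      ring
    simp only [h3]
    rw [hI]
    have hpi : (2 * (Real.pi : ℂ) * Complex.I) ≠ 0 := Complex.two_pi_I_ne_zero
    simp only [smul_eq_mul]
    field_simp

/-! ### Averaging over the circle -/

/-- Averaging an integrable function over a measure preserving action of the circle. -/
lemma integral_circleAverage {X : Type*} [MeasurableSpace X] {M : Measure X} [IsFiniteMeasure M]
    {T : ℂ → X → X} (hT : Measurable fun p : ℝ × X => T (circleMap 0 1 p.1) p.2)
    (hM : ∀ c : ℂ, ‖c‖ = 1 → MeasurePreserving (T c) M M)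
    {Φ : X → ℂ} (hΦ : Measurable Φ) (hi : Integrable Φ M) :
    Integrable (fun w => Real.circleAverage (fun c => Φ (T c w)) 0 1) M ∧
      ∫ w, Real.circleAverage (fun c => Φ (T c w)) 0 1 ∂M = ∫ w, Φ w ∂M := by
  have hc : ∀ θ : ℝ, MeasurePreserving (T (circleMap 0 1 θ)) M M := fun θ => hM _ (by simp)
  set ν : Measure ℝ := volume.restrict (Set.Ioc 0 (2 * Real.pi)) with hν
  have hint : Integrable (fun p : ℝ × X => Φ (T (circleMap 0 1 p.1) p.2)) (ν.prod M) := by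
    refine (integrable_prod_iff (hΦ.comp hT).aestronglyMeasurable).2 ⟨?_, ?_⟩
    · exact Filter.Eventually.of_forall fun θ => (hc θ).integrable_comp_of_integrable hi
    · have : ∀ θ, ∫ w, ‖Φ (T (circleMap 0 1 θ) w)‖ ∂M = ∫ w, ‖Φ w‖ ∂M := fun θ => by
        rw [← integral_map (φ := T (circleMap 0 1 θ)) (f := fun w => ‖Φ w‖)
          (hc θ).measurable.aemeasurable hΦ.norm.aestronglyMeasurable, (hc θ).map_eq]
      exact (integrable_const (∫ w, ‖Φ w‖ ∂M)).congr
        (Filter.Eventually.of_forall fun θ => (this θ).symm)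
  have hav : ∀ w, Real.circleAverage (fun c => Φ (T c w)) 0 1 =
      (2 * Real.pi)⁻¹ • ∫ θ, Φ (T (circleMap 0 1 θ) w) ∂ν := fun w => by
    rw [Real.circleAverage_def, intervalIntegral.integral_of_le (by positivity)]
  simp only [hav]
  refine ⟨hint.integral_prod_right.smul (2 * Real.pi)⁻¹, ?_⟩
  rw [integral_smul, ← integral_integral_swap (f := fun θ w => Φ (T (circleMap 0 1 θ) w)) hint]
  have : ∀ θ, ∫ w, Φ (T (circleMap 0 1 θ) w) ∂M = ∫ w, Φ w ∂M := fun θ => by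
    rw [← integral_map (φ := T (circleMap 0 1 θ)) (f := fun w => Φ w)
      (hc θ).measurable.aemeasurable hΦ.aestronglyMeasurable, (hc θ).map_eq]
  simp only [this]
  rw [integral_const, hν]
  simp [measureReal_def, ENNReal.toReal_ofReal Real.pi_nonneg]
  field_simp

/-! ### Taylor coefficients as integrals over rotation-invariant measures. -/

/-- The properties of `ρ × μ` used in the derivation of the reproducing property. -/
structure IsRotInvariant (R : ℝ≥0∞) (M : Measure (Amb (m + 2))) : Prop where
  orth : ∀ g : OrthGroup (m + 2), MeasurePreserving (orthAct g) M M
  smul : ∀ c : ℂ, ‖c‖ = 1 → MeasurePreserving (fun w : Amb (m + 2) => c • w) M M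
  ae_mem : ∀ᵐ w ∂M, w ∈ keplerBall (m + 2) R
  ae_ne : ∀ᵐ w ∂M, coordA w ≠ 0

lemma IsRotInvariant.flow {R : ℝ≥0∞} {M : Measure (Amb (m + 2))} (hM : IsRotInvariant R M) {c : ℂ}
    (hc : ‖c‖ = 1) : MeasurePreserving (flow c) M M := by
  obtain ⟨θ, rfl⟩ := exists_exp_of_norm_eq_one hc
  have h := (hM.smul _ hc).comp (hM.orth (planeRot zero_ne_one_fin (-θ)))
  convert h using 1
  funext w
  exact flow_exp θ w

/-- Truncation to balls makes every moment finite without losing the invariance. -/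
lemma IsRotInvariant.restrict {R : ℝ≥0∞} {M : Measure (Amb (m + 2))} (hM : IsRotInvariant R M)
    (k : ℝ) : IsRotInvariant R (M.restrict (Metric.closedBall 0 k)) := by
  refine ⟨fun g => ?_, fun c hc => ?_, ae_restrict_of_ae hM.ae_mem, ae_restrict_of_ae hM.ae_ne⟩
  · have h := (hM.orth g).restrict_preimage (Metric.isClosed_closedBall (x := 0) (ε := k)).measurableSet
    have e : orthAct g ⁻¹' Metric.closedBall 0 k = Metric.closedBall 0 k := by
      ext w; simp [norm_orthAct]
    rwa [e] at h
  · have h := (hM.smul c hc).restrict_preimage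
      (Metric.isClosed_closedBall (x := 0) (ε := k)).measurableSet
    have e : (fun w : Amb (m + 2) => c • w) ⁻¹' Metric.closedBall 0 k = Metric.closedBall 0 k := by
      ext w; simp [norm_smul, hc]
    rwa [e] at h

lemma isRotInvariant_rotMeasure (ρ : Measure ℝ) [IsFiniteMeasure ρ] (hρ : ρ (Set.Iic 0) = 0)
    (hR : ∀ t : ℝ, radius ρ = ENNReal.ofReal t → ρ {t} = 0) :
    IsRotInvariant (radius ρ) (rotMeasure (m + 2) ρ) :=
  ⟨measurePreserving_orthAct_rot ρ, fun _ hc => measurePreserving_smul_rot ρ hc,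
    ae_mem_keplerBall ρ hρ hR, ae_rot_coordA_ne_zero ρ hρ⟩

/-- The Taylor coefficients as integrals against the powers of `coordA`. -/
lemma integral_mul_conj_coordA_pow {R : ℝ≥0∞} {M : Measure (Amb (m + 2))} [IsFiniteMeasure M]
    (hM : IsRotInvariant R M) {F : Amb (m + 2) → ℂ} (hF : IsHolOn F (keplerBall (m + 2) R))
    (hFm : Measurable F) {a : ℕ → ℂ}
    (ha : ∀ u : ℂ, u ≠ 0 → ENNReal.ofReal ‖u‖ < R →
      ∀ l, Real.circleAverage (fun c => F ((c * u) • basePoint (m + 2)) *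
        (starRingEnd ℂ) (c * u) ^ l) 0 1 = a l * ((‖u‖ ^ (2 * l) : ℝ) : ℂ))
    (l : ℕ) (hi : Integrable (fun w => F w * (starRingEnd ℂ) (coordA w) ^ l) M) :
    ∫ w, F w * (starRingEnd ℂ) (coordA w) ^ l ∂M =
      a l * ((∫ w, ‖coordA w‖ ^ (2 * l) ∂M : ℝ) : ℂ) := by
  have hAm : Measurable (coordA (m := m)) := continuous_coordA.measurable
  have hcm : Measurable (starRingEnd ℂ) := Complex.continuous_conj.measurable
  have hpm : Measurable fun w : Amb (m + 2) => (starRingEnd ℂ) (coordA w) ^ l :=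
    (hcm.comp hAm).pow_const l
  have hΦm : Measurable fun w : Amb (m + 2) => F w * (starRingEnd ℂ) (coordA w) ^ l := hFm.mul hpm
  -- Averaging over the flow, which fixes `coordA`, replaces `F w` by its value at `coordA w • e`.
  obtain ⟨h1, h2⟩ := integral_circleAverage (T := flow)
    ((continuous_flow.comp (by fun_prop : Continuous fun p : ℝ × Amb (m + 2) =>
      (circleMap 0 1 p.1, p.2))).measurable) (fun c hc => hM.flow hc) hΦm hi
  have e1 : (fun w => Real.circleAverage (fun c => F (flow c w) *
      (starRingEnd ℂ) (coordA (flow c w)) ^ l) 0 1) =ᵐ[M]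
      fun w => F (coordA w • basePoint (m + 2)) * (starRingEnd ℂ) (coordA w) ^ l := by
    filter_upwards [hM.ae_mem, hM.ae_ne] with w hw hw0
    simp only [coordA_flow]
    rw [← circleAverage_flow hF hw hw0, mul_comm, ← smul_eq_mul, ← Real.circleAverage_fun_smul]
    simp only [smul_eq_mul, mul_comm]
  have h1' := h1.congr e1
  have hΨm : Measurable fun w : Amb (m + 2) =>
      F (coordA w • basePoint (m + 2)) * (starRingEnd ℂ) (coordA w) ^ l :=
    (hFm.comp (hAm.smul_const _)).mul hpm
  -- Averaging over scalars rotates `coordA w` around `0` and isolates the `l`-th Taylor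
  -- coefficient.
  obtain ⟨-, h4⟩ := integral_circleAverage (T := fun c (w : Amb (m + 2)) => c • w)
    ((by fun_prop : Continuous fun p : ℝ × Amb (m + 2) => circleMap 0 1 p.1 • p.2).measurable)
    hM.smul hΨm h1'
  rw [← h2, integral_congr_ae e1, ← h4, ← integral_complex_ofReal, ← integral_const_mul]
  refine integral_congr_ae ?_
  filter_upwards [hM.ae_mem, hM.ae_ne] with w hw hw0
  simp only [coordA_smul]
  refine ha _ hw0 (lt_of_le_of_lt (ENNReal.ofReal_le_ofReal ?_) hw.2) l
  have := norm_cdot_cconj_le w (basePoint (m + 2))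
  rwa [norm_basePoint, mul_one] at this

lemma norm_coordA_le (w : Amb (m + 2)) : ‖coordA w‖ ≤ ‖w‖ := by
  have := norm_cdot_cconj_le w (basePoint (m + 2))
  rwa [norm_basePoint, mul_one] at this

/-- The Taylor coefficients vanish in those degrees in which the moment is infinite. -/
lemma taylor_eq_zero_of_lintegral_eq_top {R : ℝ≥0∞} {M : Measure (Amb (m + 2))} [IsFiniteMeasure M]
    (hM : IsRotInvariant R M) {F : Amb (m + 2) → ℂ} (hF : IsHolOn F (keplerBall (m + 2) R))
    (hFm : Measurable F) (hF2 : MemLp F 2 M) {a : ℕ → ℂ}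
    (ha : ∀ u : ℂ, u ≠ 0 → ENNReal.ofReal ‖u‖ < R →
      ∀ l, Real.circleAverage (fun c => F ((c * u) • basePoint (m + 2)) *
        (starRingEnd ℂ) (c * u) ^ l) 0 1 = a l * ((‖u‖ ^ (2 * l) : ℝ) : ℂ))
    (l : ℕ) (hl : ∫⁻ w, ENNReal.ofReal (‖coordA w‖ ^ (2 * l)) ∂M = ⊤) : a l = 0 := by
  by_contra h0
  have hcA : Continuous (coordA (m := m)) := continuous_coordA
  have hF2i : Integrable (fun w => ‖F w‖ ^ 2) M := hF2.integrable_norm_pow two_ne_zero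
  have hal : 0 < ‖a l‖ ^ 2 := by positivity
  -- A Bessel inequality on each ball: `2 |a_l| |F| |a|^l ≤ |F|² + |a_l|² |a|^{2l}` and the integral
  -- formula bound the truncated moment by `‖F‖² / |a_l|²`, uniformly in `k`. Monotone convergence
  -- then contradicts the infinite moment.
  have key : ∀ k : ℕ, ∫⁻ w in Metric.closedBall 0 (k : ℝ), ENNReal.ofReal (‖coordA w‖ ^ (2 * l)) ∂M ≤
      ENNReal.ofReal ((∫ w, ‖F w‖ ^ 2 ∂M) / ‖a l‖ ^ 2) := by
    intro k
    set Mk := M.restrict (Metric.closedBall 0 (k : ℝ)) with hMk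
    have hb : ∀ᵐ w ∂Mk, ‖coordA w‖ ≤ k := by
      filter_upwards [ae_restrict_mem (Metric.isClosed_closedBall).measurableSet] with w hw
      exact (norm_coordA_le w).trans (by simpa using hw)
    have hpi : Integrable (fun w => ‖coordA w‖ ^ (2 * l)) Mk := by
      refine Integrable.of_bound (by fun_prop : Continuous _).aestronglyMeasurable
        ((k : ℝ) ^ (2 * l)) ?_
      filter_upwards [hb] with w hw
      rw [norm_pow, norm_norm]
      gcongr
    have hFk : Integrable (fun w => ‖F w‖ ^ 2) Mk := hF2i.restrict
    have hFi : Integrable F Mk :=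
      ((hF2.restrict _).mono_exponent (by norm_num : (1 : ℝ≥0∞) ≤ 2)).integrable le_rfl
    have hi : Integrable (fun w => F w * (starRingEnd ℂ) (coordA w) ^ l) Mk := by
      refine hFi.mul_bdd (c := (k : ℝ) ^ l) ?_ ?_
      · exact ((Complex.continuous_conj.comp hcA).pow l).aestronglyMeasurable
      · filter_upwards [hb] with w hw
        rw [norm_pow, RCLike.norm_conj]
        gcongr
    have h1 := integral_mul_conj_coordA_pow (hM.restrict k) hF hFm ha l hi
    have h2 : 2 * ‖a l‖ ^ 2 * ∫ w, ‖coordA w‖ ^ (2 * l) ∂Mk ≤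
        ∫ w, ‖F w‖ ^ 2 ∂Mk + ‖a l‖ ^ 2 * ∫ w, ‖coordA w‖ ^ (2 * l) ∂Mk := by
      have hn := norm_integral_le_integral_norm (μ := Mk)
        fun w => F w * (starRingEnd ℂ) (coordA w) ^ l
      rw [h1, norm_mul, Complex.norm_real, Real.norm_of_nonneg
        (integral_nonneg fun w => by positivity)] at hn
      have hn2 := mul_le_mul_of_nonneg_left hn (by positivity : 0 ≤ 2 * ‖a l‖)
      have hm : ∫ w, 2 * ‖a l‖ * ‖F w * (starRingEnd ℂ) (coordA w) ^ l‖ ∂Mk ≤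
          ∫ w, (‖F w‖ ^ 2 + ‖a l‖ ^ 2 * ‖coordA w‖ ^ (2 * l)) ∂Mk := by
        refine integral_mono (hi.norm.const_mul _) (hFk.add (hpi.const_mul _)) fun w => ?_
        simp only [norm_mul, norm_pow, RCLike.norm_conj]
        rw [mul_comm 2 l, pow_mul]
        nlinarith [sq_nonneg (‖F w‖ - ‖a l‖ * ‖coordA w‖ ^ l)]
      rw [integral_const_mul, integral_add hFk (hpi.const_mul _), integral_const_mul] at hm
      linarith
    have h3 : ∫ w, ‖F w‖ ^ 2 ∂Mk ≤ ∫ w, ‖F w‖ ^ 2 ∂M :=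
      setIntegral_le_integral hF2i (Filter.Eventually.of_forall fun w => by positivity)
    rw [← ofReal_integral_eq_lintegral_ofReal hpi
      (Filter.Eventually.of_forall fun w => by positivity)]
    refine ENNReal.ofReal_le_ofReal ?_
    rw [le_div_iff₀ hal]
    linarith
  have hU : (⋃ k : ℕ, Metric.closedBall (0 : Amb (m + 2)) (k : ℝ)) = Set.univ :=
    Metric.iUnion_closedBall_nat 0
  have hsup := setLIntegral_iUnion_of_directed (μ := M)
    (fun w : Amb (m + 2) => ENNReal.ofReal (‖coordA w‖ ^ (2 * l)))
    (s := fun k : ℕ => Metric.closedBall (0 : Amb (m + 2)) (k : ℝ))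
    (Monotone.directed_le fun i j hij => Metric.closedBall_subset_closedBall (by exact_mod_cast hij))
  rw [hU, Measure.restrict_univ, hl] at hsup
  have := iSup_le key
  rw [← hsup] at this
  exact absurd this (by simp)

end

section

variable {m : ℕ} (ρ : Measure ℝ)

/-! ### The coefficients of the kernel -/

/-- The coefficient `1 / d_l`, read as `0` if `d_l = ∞`. -/
def kerCoeff (n : ℕ) (ρ : Measure ℝ) (l : ℕ) : ℝ := (dCoeff n ρ l)⁻¹.toReal

lemma kerCoeff_nonneg (n l : ℕ) : 0 ≤ kerCoeff n ρ l := ENNReal.toReal_nonneg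

lemma summable_dimN_mul_geometric {x : ℝ} (hx0 : 0 ≤ x) (hx : x < 1) :
    Summable fun l => (dimN (m + 2) l : ℝ) * x ^ l := by
  have hs := (summable_choose_mul_geometric_of_norm_lt_one (R := ℝ) (m + 1) (r := x)
    (by rwa [Real.norm_of_nonneg hx0])).mul_left 2
  refine Summable.of_nonneg_of_le (fun l => by positivity) (fun l => ?_) hs
  have h : dimN (m + 2) l ≤ 2 * (l + (m + 1)).choose (m + 1) := by
    rw [dimN, two_mul]
    exact add_le_add le_rfl (Nat.choose_le_choose _ (by omega))
  rw [← mul_assoc]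
  gcongr
  exact_mod_cast h

/-- Choose `r` between `s` and a support point `t > s`, and `κ = ρ((r, ∞))`, which is positive as
`(r, ∞)` is a neighbourhood of `t`. -/
lemma exists_moment_lower_bound [IsFiniteMeasure ρ] {s : ℝ} (hs0 : 0 ≤ s)
    (hs : ENNReal.ofReal s < radius ρ) : ∃ r κ : ℝ, s < r ∧ 0 < κ ∧
      ∀ l, ENNReal.ofReal (κ * r ^ (2 * l)) ≤ moment ρ (2 * l) := by
  obtain ⟨_, ⟨t, ⟨ht0, ht⟩, rfl⟩, hst⟩ := lt_sSup_iff.1 hs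
  have hst' : s < t := (ENNReal.ofReal_lt_ofReal_iff ht0).1 hst
  obtain ⟨r, hsr, hrt⟩ := exists_between hst'
  have hpos : 0 < ρ (Set.Ioi r) := (Measure.mem_support_iff_forall t).1 ht _ (Ioi_mem_nhds hrt)
  have hr0 : 0 ≤ r := hs0.trans hsr.le
  refine ⟨r, (ρ (Set.Ioi r)).toReal, hsr, ENNReal.toReal_pos hpos.ne' (measure_ne_top _ _),
    fun l => ?_⟩
  rw [ENNReal.ofReal_mul ENNReal.toReal_nonneg, ENNReal.ofReal_toReal (measure_ne_top _ _),
    mul_comm, ← setLIntegral_const]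
  calc ∫⁻ _ in Set.Ioi r, ENNReal.ofReal (r ^ (2 * l)) ∂ρ
      ≤ ∫⁻ t in Set.Ioi r, ENNReal.ofReal (t ^ (2 * l)) ∂ρ := by
        refine setLIntegral_mono (by fun_prop) fun t ht => ENNReal.ofReal_le_ofReal ?_
        have : r ≤ t := le_of_lt ht
        gcongr
    _ ≤ moment ρ (2 * l) := lintegral_mono_set (Set.Ioi_subset_Ioi hr0)

/-- The number `s` serves only to witness that the radius is positive. -/
lemma dCoeff_ne_zero [IsFiniteMeasure ρ] {s : ℝ} (hs0 : 0 ≤ s) (hs : ENNReal.ofReal s < radius ρ)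
    (n l : ℕ) : dCoeff n ρ l ≠ 0 := by
  obtain ⟨r, κ, hsr, hκ, h⟩ := exists_moment_lower_bound ρ hs0 hs
  have hr : 0 < r := lt_of_le_of_lt hs0 hsr
  refine (ENNReal.div_pos (ne_of_gt (lt_of_lt_of_le ?_ (h l))) (ENNReal.natCast_ne_top _)).ne'
  exact ENNReal.ofReal_pos.2 (by positivity)

lemma kerCoeff_mul_toReal [IsFiniteMeasure ρ] {s : ℝ} (hs0 : 0 ≤ s)
    (hs : ENNReal.ofReal s < radius ρ) {n l : ℕ} (h : dCoeff n ρ l ≠ ⊤) :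
    kerCoeff n ρ l * (dCoeff n ρ l).toReal = 1 := by
  rw [kerCoeff, ← ENNReal.toReal_mul, ENNReal.inv_mul_cancel (dCoeff_ne_zero ρ hs0 hs n l) h,
    ENNReal.toReal_one]

lemma kerCoeff_eq_zero {n l : ℕ} (h : dCoeff n ρ l = ⊤) : kerCoeff n ρ l = 0 := by
  simp [kerCoeff, h]

/-- The term is the `L²` bound for the `l`-th term of the kernel at a point of norm `s`. Since `1 /
d_l ≤ N(l) / (κ r^{2l})` with `r > s`, it is dominated by a geometric series with polynomially
growing coefficients. -/
lemma summable_pow_mul_sqrt_kerCoeff [IsFiniteMeasure ρ] {s : ℝ} (hs0 : 0 ≤ s)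
    (hs : ENNReal.ofReal s < radius ρ) :
    Summable fun l => s ^ l * Real.sqrt (kerCoeff (m + 2) ρ l) := by
  obtain ⟨r, κ, hsr, hκ, h⟩ := exists_moment_lower_bound ρ hs0 hs
  have hr : 0 < r := lt_of_le_of_lt hs0 hsr
  have hx0 : 0 ≤ s / r := by positivity
  have hx1 : s / r < 1 := (div_lt_one hr).2 hsr
  have hsum := ((summable_dimN_mul_geometric (m := m) hx0 hx1).mul_left κ⁻¹).add
    (summable_geometric_of_lt_one hx0 hx1)
  refine Summable.of_nonneg_of_le (fun l => by positivity) (fun l => ?_) hsum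
  have hb : kerCoeff (m + 2) ρ l ≤ (dimN (m + 2) l : ℝ) * κ⁻¹ * (r ^ l)⁻¹ ^ 2 := by
    rw [kerCoeff, dCoeff, ENNReal.inv_div (Or.inl (ENNReal.natCast_ne_top _))
      (Or.inl (by exact_mod_cast (dimN_pos l).ne')), ENNReal.toReal_div, ENNReal.toReal_natCast]
    by_cases hq : moment ρ (2 * l) = ⊤
    · rw [hq]; simp; positivity
    · have h1 : κ * r ^ (2 * l) ≤ (moment ρ (2 * l)).toReal :=
        (ENNReal.ofReal_le_iff_le_toReal hq).1 (h l)
      calc (dimN (m + 2) l : ℝ) / (moment ρ (2 * l)).toReal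
          ≤ (dimN (m + 2) l : ℝ) / (κ * r ^ (2 * l)) := by gcongr
        _ = (dimN (m + 2) l : ℝ) * κ⁻¹ * (r ^ l)⁻¹ ^ 2 := by
          rw [mul_comm 2 l, pow_mul]; field_simp
  have hsq : Real.sqrt (kerCoeff (m + 2) ρ l) ≤ ((dimN (m + 2) l : ℝ) * κ⁻¹ + 1) * (r ^ l)⁻¹ := by
    refine (Real.sqrt_le_sqrt hb).trans ?_
    rw [Real.sqrt_mul (by positivity), Real.sqrt_sq (by positivity)]
    gcongr
    -- The crude bound `√x ≤ x + 1` avoids summing square roots of `N(l)`.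
    refine Real.sqrt_le_iff.2 ⟨by positivity, ?_⟩
    have : 0 ≤ (dimN (m + 2) l : ℝ) * κ⁻¹ := by positivity
    nlinarith
  calc s ^ l * Real.sqrt (kerCoeff (m + 2) ρ l)
      ≤ s ^ l * (((dimN (m + 2) l : ℝ) * κ⁻¹ + 1) * (r ^ l)⁻¹) := by gcongr
    _ = κ⁻¹ * ((dimN (m + 2) l : ℝ) * (s / r) ^ l) + (s / r) ^ l := by
      rw [div_pow]; ring

/-- The series is the diagonal of the product of the two summable families `s^l √b_l` and `t^l
√b_l`, where `b_l = 1 / d_l`. -/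
lemma summable_kernel [IsFiniteMeasure ρ] {s t : ℝ} (hs0 : 0 ≤ s)
    (hs : ENNReal.ofReal s < radius ρ) (ht0 : 0 ≤ t) (ht : ENNReal.ofReal t < radius ρ) :
    Summable fun l => (s * t) ^ l * kerCoeff (m + 2) ρ l := by
  have h1 := summable_pow_mul_sqrt_kerCoeff (m := m) ρ hs0 hs
  have h2 := summable_pow_mul_sqrt_kerCoeff (m := m) ρ ht0 ht
  have h := (h1.mul_of_nonneg h2 (fun l => by positivity) fun l => by positivity).comp_injective
    (i := fun l : ℕ => (l, l)) fun a b hab => (Prod.ext_iff.1 hab).1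
  refine h.congr fun l => ?_
  simp only [Function.comp_apply]
  have := Real.mul_self_sqrt (kerCoeff_nonneg ρ (m + 2) l)
  rw [mul_pow]
  linear_combination (s ^ l * t ^ l) * this

end

section

variable {n m : ℕ} (ρ : Measure ℝ)

/-! ### Functions on `R M` as functions on the ambient space -/

/-- The extension by zero of a function on a subset. -/
def zeroExtend {S : Set (Amb n)} (f : S → ℂ) : Amb n → ℂ :=
  Function.extend Subtype.val f 0

@[simp] lemma zeroExtend_coe {S : Set (Amb n)} (f : S → ℂ) (w : S) : zeroExtend f w = f w :=
  Subtype.val_injective.extend_apply f 0 w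

lemma IsHolomorphic.isHolOn {S : Set (Amb n)} {f : S → ℂ} (hf : IsHolomorphic f) :
    IsHolOn (zeroExtend f) S := by
  intro z hz
  obtain ⟨U, hU, hzU, F, hF, hfF⟩ := hf ⟨z, hz⟩
  exact ⟨U, hU, hzU, F, hF, fun w hw hwU => by
    rw [← hfF ⟨w, hw⟩ hwU, ← zeroExtend_coe f ⟨w, hw⟩]⟩

lemma measurable_zeroExtend {S : Set (Amb n)} (hS : MeasurableSet S) {f : S → ℂ}
    (hf : IsHolomorphic f) : Measurable (zeroExtend f) := by
  refine (MeasurableEmbedding.subtype_coe hS).measurable_extend ?_ measurable_const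
  have h := continuousOn_iff_continuous_domRestrict.1 hf.isHolOn.continuousOn
  have e : S.domRestrict (zeroExtend f) = f := funext fun w => zeroExtend_coe f w
  rw [e] at h
  exact h.measurable

lemma map_val_ballMeasure (hρ : ρ (Set.Iic 0) = 0)
    (hR : ∀ t : ℝ, radius ρ = ENNReal.ofReal t → ρ {t} = 0) :
    Measure.map Subtype.val (ballMeasure (m + 2) ρ) = rotMeasure (m + 2) ρ := by
  rw [ballMeasure, map_comap_subtype_coe (measurableSet_keplerBall _)]
  exact Measure.restrict_eq_self_of_ae_mem (ae_mem_keplerBall ρ hρ hR)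

lemma integral_ballMeasure (hρ : ρ (Set.Iic 0) = 0)
    (hR : ∀ t : ℝ, radius ρ = ENNReal.ofReal t → ρ {t} = 0) (F : Amb (m + 2) → ℂ) :
    ∫ w, F w ∂(ballMeasure (m + 2) ρ) = ∫ w, F w ∂(rotMeasure (m + 2) ρ) := by
  rw [← map_val_ballMeasure ρ hρ hR,
    (MeasurableEmbedding.subtype_coe (measurableSet_keplerBall _)).integral_map]

lemma memLp_ballMeasure_iff (hρ : ρ (Set.Iic 0) = 0)
    (hR : ∀ t : ℝ, radius ρ = ENNReal.ofReal t → ρ {t} = 0) (F : Amb (m + 2) → ℂ) :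
    MemLp (fun w : keplerBall (m + 2) (radius ρ) => F w) 2 (ballMeasure (m + 2) ρ) ↔
      MemLp F 2 (rotMeasure (m + 2) ρ) := by
  rw [← map_val_ballMeasure ρ hρ hR,
    (MeasurableEmbedding.subtype_coe (measurableSet_keplerBall _)).memLp_map_measure_iff]
  rfl

/-! ### The kernel -/

/-- The kernel as a function on the ambient space. -/
def kernelFun (n : ℕ) (ρ : Measure ℝ) (z w : Amb n) : ℂ :=
  ∑' l : ℕ, cdot z (cconj w) ^ l * (kerCoeff n ρ l : ℂ)

lemma norm_kernel_term_le (z w : Amb n) (l : ℕ) :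
    ‖cdot z (cconj w) ^ l * (kerCoeff n ρ l : ℂ)‖ ≤ (‖z‖ * ‖w‖) ^ l * kerCoeff n ρ l := by
  rw [norm_mul, norm_pow, Complex.norm_real, Real.norm_of_nonneg (kerCoeff_nonneg ρ n l)]
  gcongr
  · exact kerCoeff_nonneg ρ n l
  · exact norm_cdot_cconj_le z w

lemma kernelFun_symm (z w : Amb n) :
    kernelFun n ρ w z = (starRingEnd ℂ) (kernelFun n ρ z w) := by
  rw [kernelFun, kernelFun, Complex.conj_tsum]
  refine tsum_congr fun l => ?_
  rw [cdot_cconj_symm z w]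
  simp

variable [IsFiniteMeasure ρ]

lemma hasSum_kernelFun {z w : Amb (m + 2)} (hz : z ∈ keplerBall (m + 2) (radius ρ))
    (hw : w ∈ keplerBall (m + 2) (radius ρ)) :
    HasSum (fun l : ℕ => cdot z (cconj w) ^ l * (kerCoeff (m + 2) ρ l : ℂ))
      (kernelFun (m + 2) ρ z w) :=
  (Summable.of_norm_bounded (summable_kernel (m := m) ρ (norm_nonneg _) hz.2 (norm_nonneg _) hw.2)
    (norm_kernel_term_le ρ z w)).hasSum

/-- The kernel is a power series in `z · w̄`, so the same formula is holomorphic on the ambient open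
set `|z · w̄| < r' |w|`. -/
lemma isHolomorphic_kernelFun {w : Amb (m + 2)} (hw : w ∈ keplerBall (m + 2) (radius ρ)) :
    IsHolomorphic fun z : keplerBall (m + 2) (radius ρ) => kernelFun (m + 2) ρ z w := by
  intro z
  obtain ⟨r', hr', hr'R⟩ := ENNReal.lt_iff_exists_nnreal_btwn.1 z.2.2
  have hzr : ‖(z : Amb (m + 2))‖ < (r' : ℝ) := by
    exact_mod_cast (ENNReal.ofReal_lt_coe_iff (norm_nonneg _)).1 hr'
  have hr'R2 : ENNReal.ofReal (r' : ℝ) < radius ρ := by rwa [ENNReal.ofReal_coe_nnreal]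
  have hw0 : 0 < ‖w‖ := norm_pos_iff.2 hw.1.2
  refine ⟨(fun z => cdot z (cconj w)) ⁻¹' Metric.ball 0 (r' * ‖w‖),
    Metric.isOpen_ball.preimage (continuous_cdot_left _), ?_,
    fun z => kernelFun (m + 2) ρ z w, ?_, fun _ _ => rfl⟩
  · simp only [Set.mem_preimage, mem_ball_zero_iff]
    exact (norm_cdot_cconj_le _ _).trans_lt (by gcongr)
  · have h1 : DifferentiableOn ℂ (fun x : ℂ => ∑' l : ℕ, x ^ l * (kerCoeff (m + 2) ρ l : ℂ))
        (Metric.ball 0 (r' * ‖w‖)) := by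
      refine Complex.differentiableOn_tsum_of_summable_norm
        (summable_kernel (m := m) ρ r'.coe_nonneg hr'R2 (norm_nonneg w) hw.2) (fun l => by fun_prop)
        Metric.isOpen_ball fun l x hx => ?_
      rw [norm_mul, norm_pow, Complex.norm_real, Real.norm_of_nonneg (kerCoeff_nonneg ρ _ l)]
      have : ‖x‖ < r' * ‖w‖ := by simpa using hx
      gcongr
      exact kerCoeff_nonneg ρ _ l
    exact h1.comp (differentiable_cdot_left _).differentiableOn fun _ h => h

lemma eLpNorm_two_le {M : Measure (Amb n)} {f : Amb n → ℂ} {C : ℝ} (hC : 0 ≤ C)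
    (h : ∫⁻ w, ENNReal.ofReal (‖f w‖ ^ 2) ∂M ≤ ENNReal.ofReal (C ^ 2)) :
    eLpNorm f 2 M ≤ ENNReal.ofReal C := by
  have h1 := eLpNorm_nnreal_pow_eq_lintegral (μ := M) (f := f) (p := 2) two_ne_zero
  have h2 : ∫⁻ w, ‖f w‖ₑ ^ ((2 : NNReal) : ℝ) ∂M = ∫⁻ w, ENNReal.ofReal (‖f w‖ ^ 2) ∂M := by
    refine lintegral_congr fun w => ?_
    rw [ENNReal.ofReal_pow (norm_nonneg _), ofReal_norm]
    norm_num
  rw [h2] at h1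
  rw [ENNReal.ofReal_pow hC, ← h1] at h
  have h3 : eLpNorm f 2 M ^ 2 ≤ ENNReal.ofReal C ^ 2 := by
    norm_num at h
    exact h
  exact (ENNReal.pow_le_pow_left_iff two_ne_zero).1 h3

lemma lintegral_cdot_pow (hρ : ρ (Set.Iic 0) = 0) {w : Amb (m + 2)}
    (hw : w ∈ keplerManifold (m + 2)) (l : ℕ) :
    ∫⁻ z, ENNReal.ofReal (‖cdot z (cconj w)‖ ^ (2 * l)) ∂(rotMeasure (m + 2) ρ) =
      ENNReal.ofReal (‖w‖ ^ (2 * l)) * dCoeff (m + 2) ρ l := by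
  obtain ⟨g, hg⟩ := exists_smul_orthAct_basePoint hw
  have hA := continuous_coordA (m := m)
  have hc := continuous_cdot_left (cconj w)
  have hm : Measurable fun z => ENNReal.ofReal (‖cdot z (cconj w)‖ ^ (2 * l)) :=
    ENNReal.measurable_ofReal.comp (by fun_prop : Continuous _).measurable
  have hm' : Measurable fun z : Amb (m + 2) => ENNReal.ofReal (‖coordA z‖ ^ (2 * l)) :=
    ENNReal.measurable_ofReal.comp (by fun_prop : Continuous _).measurable
  rw [← (measurePreserving_orthAct_rot ρ g).lintegral_comp hm, ← lintegral_coordA_rot ρ hρ,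
    ← lintegral_const_mul _ hm']
  refine lintegral_congr fun z => ?_
  rw [← ENNReal.ofReal_mul (by positivity)]
  congr 1
  rw [← mul_pow]
  congr 1
  nth_rewrite 1 [hg]
  rw [cdot_cconj_orthAct, cconj_smul, cdot_smul_right, Complex.conj_ofReal, norm_mul,
    Complex.norm_real, norm_norm]
  rfl

/-- With `b_l = 1 / d_l`, the `l`-th term has squared norm `b_l² |w|^{2l} d_l = b_l |w|^{2l}`. The
norms are summable, and lower semicontinuity of the norm passes the bound from the partial sums to
the kernel. -/
lemma memLp_kernelFun (hρ : ρ (Set.Iic 0) = 0)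
    (hR : ∀ t : ℝ, radius ρ = ENNReal.ofReal t → ρ {t} = 0) {w : Amb (m + 2)}
    (hw : w ∈ keplerBall (m + 2) (radius ρ)) :
    MemLp (fun z => kernelFun (m + 2) ρ z w) 2 (rotMeasure (m + 2) ρ) := by
  have hc := continuous_cdot_left (cconj w)
  have hsum := summable_pow_mul_sqrt_kerCoeff (m := m) ρ (norm_nonneg w) hw.2
  have hts : ∀ l, AEStronglyMeasurable
      (fun z => cdot z (cconj w) ^ l * (kerCoeff (m + 2) ρ l : ℂ)) (rotMeasure (m + 2) ρ) :=
    fun l => (by fun_prop : Continuous _).aestronglyMeasurable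
  have hterm : ∀ l, eLpNorm (fun z => cdot z (cconj w) ^ l * (kerCoeff (m + 2) ρ l : ℂ)) 2
      (rotMeasure (m + 2) ρ) ≤
      ENNReal.ofReal (‖w‖ ^ l * Real.sqrt (kerCoeff (m + 2) ρ l)) := by
    intro l
    have hb := kerCoeff_nonneg ρ (m + 2) l
    refine eLpNorm_two_le (by positivity) ?_
    have e : ∀ z, ENNReal.ofReal (‖cdot z (cconj w) ^ l * (kerCoeff (m + 2) ρ l : ℂ)‖ ^ 2) =
        ENNReal.ofReal (kerCoeff (m + 2) ρ l ^ 2) *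
          ENNReal.ofReal (‖cdot z (cconj w)‖ ^ (2 * l)) := fun z => by
      rw [← ENNReal.ofReal_mul (by positivity), norm_mul, norm_pow, Complex.norm_real,
        Real.norm_of_nonneg hb]
      congr 1
      ring
    simp only [e]
    have hm : Measurable fun z => ENNReal.ofReal (‖cdot z (cconj w)‖ ^ (2 * l)) :=
      ENNReal.measurable_ofReal.comp (by fun_prop : Continuous _).measurable
    rw [lintegral_const_mul _ hm, lintegral_cdot_pow ρ hρ hw.1]
    by_cases hd : dCoeff (m + 2) ρ l = ⊤
    · simp [kerCoeff_eq_zero ρ hd]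
    · rw [← ENNReal.ofReal_toReal hd, ← ENNReal.ofReal_mul (by positivity),
        ← ENNReal.ofReal_mul (by positivity)]
      refine ENNReal.ofReal_le_ofReal (le_of_eq ?_)
      have h1 := kerCoeff_mul_toReal ρ (norm_nonneg w) hw.2 hd
      rw [mul_pow, Real.sq_sqrt hb]
      linear_combination (kerCoeff (m + 2) ρ l * ‖w‖ ^ (2 * l)) * h1
  have hlim : ∀ᵐ z ∂(rotMeasure (m + 2) ρ), Filter.Tendsto
      (fun N => (∑ l ∈ Finset.range N,
        fun z => cdot z (cconj w) ^ l * (kerCoeff (m + 2) ρ l : ℂ)) z)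
      Filter.atTop (nhds (kernelFun (m + 2) ρ z w)) := by
    filter_upwards [ae_mem_keplerBall ρ hρ hR] with z hz
    simpa only [Finset.sum_apply] using (hasSum_kernelFun ρ hz hw).tendsto_sum_nat
  have hms : ∀ N, AEStronglyMeasurable (∑ l ∈ Finset.range N,
      fun z => cdot z (cconj w) ^ l * (kerCoeff (m + 2) ρ l : ℂ)) (rotMeasure (m + 2) ρ) :=
    fun N => Finset.aestronglyMeasurable_sum _ fun l _ => hts l
  refine ⟨aestronglyMeasurable_of_tendsto_ae _ hms hlim, ?_⟩
  refine lt_of_le_of_lt (Lp.eLpNorm_lim_le_liminf_eLpNorm hms _ hlim) ?_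
  refine lt_of_le_of_lt (b := ENNReal.ofReal
    (∑' l, ‖w‖ ^ l * Real.sqrt (kerCoeff (m + 2) ρ l))) ?_ ENNReal.ofReal_lt_top
  refine Filter.liminf_le_of_le (by isBoundedDefault) fun b hb => ?_
  obtain ⟨N, hN⟩ := hb.exists
  refine hN.trans ((eLpNorm_sum_le (fun l _ => hts l) (by norm_num)).trans ?_)
  refine (Finset.sum_le_sum fun l _ => hterm l).trans ?_
  rw [← ENNReal.ofReal_sum_of_nonneg fun l _ => by positivity]
  exact ENNReal.ofReal_le_ofReal (hsum.sum_le_tsum _ fun l _ => by positivity)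

/-! ### The reproducing property -/

lemma eq_integral_mul_kernelFun (hρ : ρ (Set.Iic 0) = 0)
    (hR : ∀ t : ℝ, radius ρ = ENNReal.ofReal t → ρ {t} = 0) {F : Amb (m + 2) → ℂ}
    (hF : IsHolOn F (keplerBall (m + 2) (radius ρ))) (hFm : Measurable F)
    (hF2 : MemLp F 2 (rotMeasure (m + 2) ρ)) {z : Amb (m + 2)}
    (hz : z ∈ keplerBall (m + 2) (radius ρ)) :
    F z = ∫ w, F w * kernelFun (m + 2) ρ z w ∂(rotMeasure (m + 2) ρ) := by
  set M := rotMeasure (m + 2) ρ with hMdef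
  have hM := isRotInvariant_rotMeasure (m := m) ρ hρ hR
  -- Rotate `z` to `s e`: `H = F ∘ g` has the same integrability properties, and `z · w̄` becomes
  -- `s` times the conjugate of `coordA`.
  obtain ⟨g, hg⟩ := exists_smul_orthAct_basePoint hz.1
  set s : ℝ := ‖z‖ with hs
  have hs0 : 0 < s := norm_pos_iff.2 hz.1.2
  set H : Amb (m + 2) → ℂ := fun w => F (orthAct g w) with hH
  have hHol : IsHolOn H (keplerBall (m + 2) (radius ρ)) := hF.comp_orthAct g
  have hHm : Measurable H := hFm.comp (continuous_orthAct_right g).measurable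
  have hH2 : MemLp H 2 M := hF2.comp_measurePreserving (hM.orth g)
  have hH2i : Integrable (fun w => ‖H w‖ ^ 2) M := hH2.integrable_norm_pow two_ne_zero
  obtain ⟨a, ha⟩ := exists_taylor_smul_basePoint hHol
  have ha2 := fun u hu huR => (ha u hu huR).2
  have hA : Continuous (coordA (m := m)) := continuous_coordA
  have hcc := Complex.continuous_conj
  have hsu : HasSum (fun l => a l * (s : ℂ) ^ l) (F z) := by
    have h := (ha (s : ℂ) (by exact_mod_cast hs0.ne') (by
      rw [Complex.norm_real, Real.norm_of_nonneg hs0.le]; exact hz.2)).1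
    simp only [hH] at h
    rwa [← hg] at h
  have hK : ∫ w, F w * kernelFun (m + 2) ρ z w ∂M =
      ∫ w, ∑' l : ℕ, H w * ((s * (starRingEnd ℂ) (coordA w)) ^ l *
        (kerCoeff (m + 2) ρ l : ℂ)) ∂M := by
    have hKm : AEStronglyMeasurable (fun w => kernelFun (m + 2) ρ z w) M := by
      simp only [fun w => kernelFun_symm ρ w z]
      exact hcc.comp_aestronglyMeasurable (memLp_kernelFun ρ hρ hR hz).aestronglyMeasurable
    have hmap : Measure.map (orthAct g) M = M := (hM.orth g).map_eq
    have hFK : AEStronglyMeasurable (fun w => F w * kernelFun (m + 2) ρ z w)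
        (Measure.map (orthAct g) M) := by
      rw [hmap]
      exact hFm.aestronglyMeasurable.mul hKm
    nth_rewrite 1 [← hmap]
    rw [integral_map (continuous_orthAct_right g).measurable.aemeasurable hFK]
    refine integral_congr_ae (Filter.Eventually.of_forall fun w => ?_)
    simp only [hH, kernelFun, tsum_mul_left]
    congr 1
    refine tsum_congr fun l => ?_
    congr 2
    nth_rewrite 1 [hg]
    rw [cdot_cconj_orthAct, cdot_smul_left, cdot_cconj_symm]
    rfl
  have hmom : ∀ l, dCoeff (m + 2) ρ l ≠ ⊤ → Integrable (fun w => ‖coordA w‖ ^ (2 * l)) M ∧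
      ∫ w, ‖coordA w‖ ^ (2 * l) ∂M = (dCoeff (m + 2) ρ l).toReal := by
    intro l hl
    have h1 := lintegral_coordA_rot (m := m) ρ hρ l
    have hint : Integrable (fun w => ‖coordA w‖ ^ (2 * l)) M := by
      refine ⟨(by fun_prop : Continuous _).aestronglyMeasurable, ?_⟩
      rw [hasFiniteIntegral_iff_ofReal (Filter.Eventually.of_forall fun w => by positivity), h1]
      exact lt_top_iff_ne_top.2 hl
    refine ⟨hint, ?_⟩
    rw [integral_eq_lintegral_of_nonneg_ae (Filter.Eventually.of_forall fun w => by positivity)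
      hint.aestronglyMeasurable, h1]
  have hprod : ∀ l, dCoeff (m + 2) ρ l ≠ ⊤ →
      Integrable (fun w => H w * (starRingEnd ℂ) (coordA w) ^ l) M := by
    intro l hl
    refine (hH2i.add (hmom l hl).1).mono' ?_ (Filter.Eventually.of_forall fun w => ?_)
    · exact (hHm.mul ((by fun_prop : Continuous fun w : Amb (m + 2) =>
        (starRingEnd ℂ) (coordA w) ^ l).measurable)).aestronglyMeasurable
    · simp only [norm_mul, norm_pow, RCLike.norm_conj, Pi.add_apply]
      rw [mul_comm 2 l, pow_mul]
      nlinarith [sq_nonneg (‖H w‖ - ‖coordA w‖ ^ l), sq_nonneg (‖H w‖),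
        sq_nonneg (‖coordA w‖ ^ l)]
  have hterm : ∀ l w, H w * ((s * (starRingEnd ℂ) (coordA w)) ^ l *
      (kerCoeff (m + 2) ρ l : ℂ)) = ((s : ℂ) ^ l * kerCoeff (m + 2) ρ l) *
        (H w * (starRingEnd ℂ) (coordA w) ^ l) := fun l w => by ring
  have hti : ∀ l, Integrable (fun w => H w * ((s * (starRingEnd ℂ) (coordA w)) ^ l *
      (kerCoeff (m + 2) ρ l : ℂ))) M := by
    intro l
    by_cases hd : dCoeff (m + 2) ρ l = ⊤
    · simp [kerCoeff_eq_zero ρ hd]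
    · simp only [hterm]
      exact (hprod l hd).const_mul _
  have hval : ∀ l, ∫ w, H w * ((s * (starRingEnd ℂ) (coordA w)) ^ l *
      (kerCoeff (m + 2) ρ l : ℂ)) ∂M = a l * (s : ℂ) ^ l := by
    intro l
    by_cases hd : dCoeff (m + 2) ρ l = ⊤
    · rw [taylor_eq_zero_of_lintegral_eq_top hM hHol hHm hH2 ha2 l
        (by rw [lintegral_coordA_rot ρ hρ, hd])]
      simp [kerCoeff_eq_zero ρ hd]
    · simp only [hterm]
      rw [integral_const_mul, integral_mul_conj_coordA_pow hM hHol hHm ha2 l (hprod l hd),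
        (hmom l hd).2]
      have h1 : (kerCoeff (m + 2) ρ l : ℂ) * ((dCoeff (m + 2) ρ l).toReal : ℂ) = 1 := by
        exact_mod_cast kerCoeff_mul_toReal ρ hs0.le hz.2 hd
      linear_combination (s ^ l * a l) * h1
  -- Domination for termwise integration. With `b = 1 / d_l`, one factor `√b` is kept with `|a|^l`,
  -- because `∫ b |a|^{2l} = 1`; then `xy ≤ x² + y²` bounds the integral by `s^l √b (‖H‖² + 1)`.
  have hsn : Summable fun l => ∫ w, ‖H w * ((s * (starRingEnd ℂ) (coordA w)) ^ l *
      (kerCoeff (m + 2) ρ l : ℂ))‖ ∂M := by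
    refine Summable.of_nonneg_of_le (fun l => integral_nonneg fun w => norm_nonneg _)
      (fun l => ?_) ((summable_pow_mul_sqrt_kerCoeff (m := m) ρ hs0.le hz.2).mul_right
        (∫ w, ‖H w‖ ^ 2 ∂M + 1))
    by_cases hd : dCoeff (m + 2) ρ l = ⊤
    · simp [kerCoeff_eq_zero ρ hd]
    · set b := kerCoeff (m + 2) ρ l with hb
      have hb0 : 0 ≤ b := kerCoeff_nonneg ρ _ l
      have hbb := Real.mul_self_sqrt hb0
      have hI : ∫ w, s ^ l * Real.sqrt b * (‖H w‖ ^ 2 + b * ‖coordA w‖ ^ (2 * l)) ∂M =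
          s ^ l * Real.sqrt b * (∫ w, ‖H w‖ ^ 2 ∂M + 1) := by
        rw [integral_const_mul, integral_add hH2i ((hmom l hd).1.const_mul _), integral_const_mul,
          (hmom l hd).2, kerCoeff_mul_toReal ρ hs0.le hz.2 hd]
      rw [← hI]
      refine integral_mono (hti l).norm ((hH2i.add ((hmom l hd).1.const_mul _)).const_mul _)
        fun w => ?_
      simp only [norm_mul, norm_pow, RCLike.norm_conj, Complex.norm_real, mul_pow,
        Real.norm_of_nonneg hs0.le, Real.norm_of_nonneg hb0]
      have h1 : ‖H w‖ * (Real.sqrt b * ‖coordA w‖ ^ l) ≤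
          ‖H w‖ ^ 2 + b * ‖coordA w‖ ^ (2 * l) := by
        rw [mul_comm 2 l, pow_mul]
        nlinarith [sq_nonneg (‖H w‖ - Real.sqrt b * ‖coordA w‖ ^ l), sq_nonneg (‖H w‖),
          sq_nonneg (Real.sqrt b * ‖coordA w‖ ^ l)]
      calc ‖H w‖ * (s ^ l * ‖coordA w‖ ^ l * b)
          = s ^ l * Real.sqrt b * (‖H w‖ * (Real.sqrt b * ‖coordA w‖ ^ l)) := by
            linear_combination (-(‖H w‖ * (s ^ l * ‖coordA w‖ ^ l))) * hbb
        _ ≤ s ^ l * Real.sqrt b * (‖H w‖ ^ 2 + b * ‖coordA w‖ ^ (2 * l)) := by gcongr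
  have hfin := hasSum_integral_of_summable_integral_norm hti hsn
  simp only [hval] at hfin
  rw [hK]
  exact hsu.unique hfin

end

section

variable {n m : ℕ} (ρ : Measure ℝ)

/-! ### The reproducing kernel of the Bergman space -/

lemma isReproducingKernel_kernelFun [IsFiniteMeasure ρ] (hρ : ρ (Set.Iic 0) = 0)
    (hR : ∀ t : ℝ, radius ρ = ENNReal.ofReal t → ρ {t} = 0) :
    IsReproducingKernel (m + 2) ρ fun z w => kernelFun (m + 2) ρ z w := by
  have hmem : ∀ w : keplerBall (m + 2) (radius ρ),
      MemLp (fun z : keplerBall (m + 2) (radius ρ) => kernelFun (m + 2) ρ z w) 2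
        (ballMeasure (m + 2) ρ) := fun w =>
    (memLp_ballMeasure_iff ρ hρ hR fun z => kernelFun (m + 2) ρ z w).2
      (memLp_kernelFun ρ hρ hR w.2)
  have hrep : ∀ f ∈ bergmanSpace (m + 2) ρ, ∀ z : keplerBall (m + 2) (radius ρ),
      Integrable (fun w : keplerBall (m + 2) (radius ρ) => f w * kernelFun (m + 2) ρ z w)
        (ballMeasure (m + 2) ρ) ∧
      f z = ∫ w, f w * kernelFun (m + 2) ρ z w ∂(ballMeasure (m + 2) ρ) := by
    intro f hf z
    obtain ⟨hf, hf2⟩ : IsHolomorphic f ∧ MemLp f 2 (ballMeasure (m + 2) ρ) := hf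
    have hz2 : MemLp (fun w : keplerBall (m + 2) (radius ρ) => kernelFun (m + 2) ρ z w) 2
        (ballMeasure (m + 2) ρ) := by
      have h : (fun w : keplerBall (m + 2) (radius ρ) => kernelFun (m + 2) ρ z w) =
          star fun w : keplerBall (m + 2) (radius ρ) => kernelFun (m + 2) ρ w z :=
        funext fun w => kernelFun_symm ρ (w : Amb (m + 2)) z
      rw [h]
      exact (hmem z).star
    refine ⟨hf2.integrable_mul hz2, ?_⟩
    have hF2 : MemLp (zeroExtend f) 2 (rotMeasure (m + 2) ρ) := by
      rw [← memLp_ballMeasure_iff ρ hρ hR]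
      simpa only [zeroExtend_coe] using hf2
    have h := eq_integral_mul_kernelFun ρ hρ hR hf.isHolOn
      (measurable_zeroExtend (measurableSet_keplerBall _) hf) hF2 z.2
    rw [← integral_ballMeasure ρ hρ hR] at h
    simpa only [zeroExtend_coe] using h
  exact ⟨fun w => ⟨isHolomorphic_kernelFun ρ w.2, hmem w⟩,
    fun z w => kernelFun_symm ρ (z : Amb (m + 2)) w, hrep⟩

/-- Reproduce `K₁(·, w)` with `K₂` and `K₂(·, z)` with `K₁`: by the Hermitian symmetry the two
integrals are conjugate to each other. -/
lemma IsReproducingKernel.unique {ρ : Measure ℝ}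
    {K₁ K₂ : keplerBall n (radius ρ) → keplerBall n (radius ρ) → ℂ}
    (h₁ : IsReproducingKernel n ρ K₁) (h₂ : IsReproducingKernel n ρ K₂) : K₁ = K₂ := by
  funext z w
  rw [(h₂.reproducing _ (h₁.mem w) z).2, h₂.symm w z, (h₁.reproducing _ (h₂.mem z) w).2,
    ← integral_conj]
  refine integral_congr_ae (Filter.Eventually.of_forall fun u => ?_)
  simp only [map_mul]
  rw [h₂.symm u z, h₁.symm u w]
  simp [mul_comm]

end

end Kepler

end

/-- Here `K` exists, is unique, and is given by the stated series; a term with `d_l = ∞` is `0`. -/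
theorem mainTheorem1 (n : ℕ) (hn : 2 ≤ n) (ρ : Measure ℝ) [IsFiniteMeasure ρ]
    (hρ : ρ (Set.Iic 0) = 0)
    (hR : ∀ t : ℝ, Kepler.radius ρ = ENNReal.ofReal t → ρ {t} = 0) :
    (∃! K : Kepler.keplerBall n (Kepler.radius ρ) → Kepler.keplerBall n (Kepler.radius ρ) → ℂ,
        Kepler.IsReproducingKernel n ρ K) ∧
    (∀ K : Kepler.keplerBall n (Kepler.radius ρ) → Kepler.keplerBall n (Kepler.radius ρ) → ℂ,
      Kepler.IsReproducingKernel n ρ K →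
        ∀ z w : Kepler.keplerBall n (Kepler.radius ρ),
          HasSum (fun l : ℕ => Kepler.cdot (z : Kepler.Amb n) (Kepler.cconj w) ^ l *
            (((Kepler.dCoeff n ρ l)⁻¹.toReal : ℝ) : ℂ)) (K z w)) ∧
    (∀ l : ℕ, (Kepler.dimN n l : ℚ) =
      ((2 * l + n - 1 : ℕ) : ℚ) * ((l + n - 2).factorial : ℚ) /
        ((l.factorial : ℚ) * ((n - 1).factorial : ℚ))) := by
  -- Writing `n = m + 2` removes the truncated subtractions and exposes the two coordinates of the
  -- base point.
  obtain ⟨m, rfl⟩ : ∃ m, n = m + 2 := ⟨n - 2, by omega⟩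
  have hK := Kepler.isReproducingKernel_kernelFun (m := m) ρ hρ hR
  refine ⟨⟨_, hK, fun K h => h.unique hK⟩, fun K h z w => ?_, fun l => ?_⟩
  · rw [h.unique hK]
    exact Kepler.hasSum_kernelFun ρ z.2 w.2
  · rw [Kepler.dimN_factorial, show 2 * l + (m + 2) - 1 = 2 * l + m + 1 by omega,
      show l + (m + 2) - 2 = l + m by omega, show m + 2 - 1 = m + 1 by omega]
    push_cast
    ring
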